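/- Let $d\ge 1$ be an integer, let $\|\cdot\|_F$ be the Frobenius norm, and for $\beta>0$ put $$c_\beta(d)=\frac{\beta^{2}\left[3d(d-1)+1\right]+2\beta(3d-1)+4}{d\left(\beta d^{2}+2\right)^{2}}.$$ **(a) $\beta=1,2,4$.** Let $F=\mathbb R,\mathbb C,\mathbb H$ for $\beta=1,2,4$ respectively, and let $u,v$ be independent random vectors, each uniformly distributed on the unit sphere of $F^{d^2}$, reshaped as $d\times d$ matrices with entries in $F$. Then $$\mathbb E\|uv\|_F^2=\frac1d,\qquad \mathbb E\left\|uv(uv)^\dagger\right\|_F^2=c_\beta(d).$$ **(b) General real $\beta>0$.** The same two identities hold for independent $u,v$ uniform on the $\beta$-sphere, in the following sense. The vector $a=(a_1,\dots,a_d)$ of squared singular values of $u$ has the law of $x/\sum_i x_i$, where $x\in(0,\infty)^d$ has density proportional to $$\prod_i x_i^{\beta/2-1}e^{-x_i/2}\prod_{i<j}|x_i-x_j|^\beta;$$ the vector $b$ of squared singular values of $v$ is independent of $a$ with the same law; and the singular vectors are independent $\beta$-Haar, so that $\|uv\|_F^2$ and $\|uv(uv)^\dagger\|_F^2$ are the power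 sums $p_1,p_2$ of the eigenvalues of $\mathrm{diag}(a)\,Q\,\mathrm{diag}(b)\,Q^\dagger$ with $Q$ a $\beta$-Haar $d\times d$ matrix. The average over $Q$ of a symmetric polynomial of these eigenvalues is defined linearly by $J_\kappa\mapsto J_\kappa(a)J_\kappa(b)/J_\kappa(1,\dots,1)$ on the Jack polynomials $J_\kappa$ with parameter $2/\beta$ (terms with $J_\kappa$ identically zero in $d$ variables are omitted), where $J_{(1)}=p_1$, $J_{(2)}=p_1^2+\frac2\beta p_2$, $J_{(1,1)}=p_1^2-p_2$. That is, $$\mathbb E_{a,b}\left[\frac{J_{(1)}(a)J_{(1)}(b)}{J_{(1)}(1^d)}\right]=\frac1d,\qquad \mathbb E_{a,b}\left[\frac{1}{1+2/\beta}\left(\frac{J_{(2)}(a)J_{(2)}(b)}{J_{(2)}(1^d)}-\frac{J_{(1,1)}(a)J_{(1,1)}(b)}{J_{(1,1)}(1^d)}\right)\right]=c_\beta(d).$$ All random variables involved are integrable. -/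

import Mathlib

open MeasureTheory ProbabilityTheory
open scoped Matrix

noncomputable section

namespace BetaSphere

/-! ### The three concrete cases: real, complex and quaternionic entries -/

/-- The quaternions carry their Borel sigma-algebra. -/
instance instMeasurableSpaceQuaternion : MeasurableSpace (Quaternion ℝ) := borel _

instance instBorelSpaceQuaternion : BorelSpace (Quaternion ℝ) := ⟨rfl⟩

/-- The space `F^(d²)` of vectors of two sites of local dimension `d`, coordinates indexed by
pairs, with its Euclidean norm `‖x‖² = ∑ |x (i, j)|²`. -/
abbrev TwoSite (F : Type) [NormedAddCommGroup F] (d : ℕ) : Type :=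
  PiLp 2 (fun _ : Fin d × Fin d => F)

/-- The uniform probability measure on the unit sphere of a finite-dimensional Euclidean space,
viewed as a measure on the whole space: normalized surface measure. -/
def uniformSphere (E : Type) [NormedAddCommGroup E] [InnerProductSpace ℝ E]
    [FiniteDimensional ℝ E] [MeasurableSpace E] [BorelSpace E] : Measure E :=
  (((volume : Measure E).toSphere Set.univ)⁻¹ • (volume : Measure E).toSphere).map
    Subtype.val

/-- A vector of `F^(d²)` reshaped as a `d × d` matrix. -/
def reshape {F : Type} [NormedAddCommGroup F] {d : ℕ} (x : TwoSite F d) :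
    Matrix (Fin d) (Fin d) F :=
  Matrix.of fun i j => x (i, j)

/-- The squared Frobenius norm. -/
def frobSq {F : Type} [NormedAddCommGroup F] {d : ℕ} (M : Matrix (Fin d) (Fin d) F) : ℝ :=
  ∑ i, ∑ j, ‖M i j‖ ^ 2

/-- `X` is integrable and its expectation is `m`. -/
def HasMean {Ω : Type*} [MeasurableSpace Ω] (P : Measure Ω) (X : Ω → ℝ) (m : ℝ) : Prop :=
  Integrable X P ∧ ∫ ω, X ω ∂P = m

/-! ### General `β`

For general `β > 0` there is no algebra of entries.  A matrix `u` uniform on the `β`-sphere is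
given by its singular value decomposition: its squared singular values follow the trace-normalized
`β`-Laguerre (`β`-Wishart) ensemble, and its singular vectors are `β`-Haar and independent of
them.  If `a`, `b` are the squared singular values of `u`, `v`, then those of `u v` are the
eigenvalues of `diag a * Q * diag b * Qᴴ` with `Q` a `d × d` `β`-Haar matrix, and the average over
`Q` of a symmetric polynomial in these eigenvalues is defined by linearity from the rule
`J_κ ↦ J_κ(a) J_κ(b) / J_κ(1, …, 1)` on Jack polynomials `J_κ` of parameter `2 / β`. -/

/-- The unnormalized density of the eigenvalues of the square `d × d` `β`-Wishart matrix `G Gᴴ`,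
on the positive orthant. -/
def laguerreWeight (β : ℝ) (d : ℕ) (x : Fin d → ℝ) : ℝ :=
  (∏ i, x i ^ (β / 2 - 1) * Real.exp (-x i / 2)) *
    ∏ i, ∏ j ∈ Finset.Ioi i, |x i - x j| ^ β

/-- The weight as a measure, not yet normalized. -/
def laguerreMeasure (β : ℝ) (d : ℕ) : Measure (Fin d → ℝ) :=
  ((volume : Measure (Fin d → ℝ)).restrict {x | ∀ i, 0 < x i}).withDensity
    fun x => ENNReal.ofReal (laguerreWeight β d x)

/-- The `β`-Laguerre ensemble, a probability measure. -/
def betaLaguerre (β : ℝ) (d : ℕ) : Measure (Fin d → ℝ) :=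
  (laguerreMeasure β d Set.univ)⁻¹ • laguerreMeasure β d

/-- The law of the squared singular values of a `d × d` matrix uniform on the `β`-sphere, that is
of `G / ‖G‖_F` with `G` a `β`-Gaussian matrix. -/
def sphereSpectrum (β : ℝ) (d : ℕ) : Measure (Fin d → ℝ) :=
  (betaLaguerre β d).map fun x i => x i / ∑ j, x j

/-- The power sum `p_k`. -/
def powerSum {d : ℕ} (k : ℕ) (a : Fin d → ℝ) : ℝ := ∑ i, a i ^ k

/-- The Jack polynomial of the partition `(1)`. -/
def jack1 {d : ℕ} (a : Fin d → ℝ) : ℝ := powerSum 1 a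

/-- The Jack polynomial of the partition `(2)`, with parameter `2 / β`. -/
def jack2 (β : ℝ) {d : ℕ} (a : Fin d → ℝ) : ℝ :=
  powerSum 1 a ^ 2 + 2 / β * powerSum 2 a

/-- The Jack polynomial of the partition `(1, 1)`. -/
def jack11 {d : ℕ} (a : Fin d → ℝ) : ℝ := powerSum 1 a ^ 2 - powerSum 2 a

theorem powerSum_one_eq {d : ℕ} (a : Fin d → ℝ) : powerSum 1 a = jack1 a := rfl

/-- The expansion of `p₂` in Jack polynomials. -/
theorem powerSum_two_eq {β : ℝ} (hβ : 0 < β) {d : ℕ} (a : Fin d → ℝ) :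
    powerSum 2 a = (1 + 2 / β)⁻¹ * jack2 β a - (1 + 2 / β)⁻¹ * jack11 a := by
  have h : 1 + 2 / β ≠ 0 := by positivity
  have h' : jack2 β a - jack11 a = (1 + 2 / β) * powerSum 2 a := by
    unfold jack2 jack11; ring
  rw [← mul_sub, h', inv_mul_cancel_left₀ h]

/-- The `β`-Haar average over `Q` of `p₁ = Tr` of `diag a * Q * diag b * Qᴴ`, that is of
`‖u v‖_F²` for given squared singular values `a` of `u` and `b` of `v`. -/
def haarMeanTr {d : ℕ} (a b : Fin d → ℝ) : ℝ :=
  jack1 a * jack1 b / jack1 (1 : Fin d → ℝ)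

/-- The `β`-Haar average over `Q` of `p₂`, the trace of the square of `diag a * Q * diag b * Qᴴ`,
that is of `‖u v (u v)ᴴ‖_F²`.  For `d = 1` the polynomial of `(1, 1)` vanishes and the second
term is `0`. -/
def haarMeanTrSq (β : ℝ) {d : ℕ} (a b : Fin d → ℝ) : ℝ :=
  (1 + 2 / β)⁻¹ * (jack2 β a * jack2 β b / jack2 β (1 : Fin d → ℝ))
    - (1 + 2 / β)⁻¹ * (jack11 a * jack11 b / jack11 (1 : Fin d → ℝ))

/-- The value of the fourth-order expectation. -/
def quarticValue (β : ℝ) (d : ℕ) : ℝ :=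
  (β ^ 2 * (3 * (d : ℝ) * ((d : ℝ) - 1) + 1) + 2 * β * (3 * (d : ℝ) - 1) + 4) /
    ((d : ℝ) * (β * (d : ℝ) ^ 2 + 2) ^ 2)

end BetaSphere

end

/-! Part (a) is Wick calculus on the sphere of real dimension `n = β d²`. Isometry invariance makes
the `k`-th moment of a linear functional a constant times the `k`-th power of its norm. Polarization
then gives all second and fourth moments as sums over pairings, and `‖x‖ = 1` fixes the constants
`1/n` and `1/(n(n+2))` (`integral_inner_mul_inner`, `integral_inner_mul_inner_mul_inner_mul_inner`).
For fixed `B = v v†` the entries of `u B u†` are quadratic in `u`. The three pairings contribute the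
squared trace of `B`, its Frobenius norm, and a twisted term in which the algebra of entries appears
only through the factor `2β - β²` (`integral_frobSq_conj`). The case `B = 1` gives the mean purity
`m = (2βd - β + 2)/(βd² + 2)`. Averaging `u` and then `v` gives the result.

In part (b) the spectra satisfy `p₁ = 1` almost surely, so each Jack polynomial is affine in `p₂`,
and independence reduces everything to `E p₂ = m`. Write `⟨f⟩` for the integral of `f` against the
Laguerre weight and `s = ∑ xᵢ`. Two integrations by parts suffice. Scaling gives `⟨h s⟩ = (βd² +
2k)⟨h⟩` for `h ≥ 0` homogeneous of degree `k` (`setIntegral_laguerreWeight_mul_sum`). The field `xᵢ²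
∂ᵢ` gives `⟨p₂⟩ = 2c⟨p₁⟩` with `c = β/2 + 1 + β(d-1)` (`half_secondMoment_le`,
`le_half_secondMoment`). Together they give `⟨p₂/s²⟩ = m⟨1⟩`.

Neither integration by parts differentiates the weight, which is singular at the walls and, for
small `β`, on the diagonals. The flows are applied as exact changes of variables. Both are Möbius
maps `x ↦ l x/(1 + t x)` in each coordinate, under which every difference `xᵢ - xⱼ` acquires an
explicit factor. First-order inequalities for the exponential replace differentiation under the
integral. -/

noncomputable section

namespace BetaSphere

/-! ### Invariance and low moments of the uniform measure on the sphere -/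

section Sphere

variable {E : Type} [NormedAddCommGroup E] [InnerProductSpace ℝ E]
  [FiniteDimensional ℝ E] [MeasurableSpace E] [BorelSpace E]

instance isProbabilityMeasure_uniformSphere [Nontrivial E] :
    IsProbabilityMeasure (uniformSphere E) := by
  have h : IsProbabilityMeasure (((volume : Measure E).toSphere Set.univ)⁻¹ •
      (volume : Measure E).toSphere) := by
    constructor
    rw [Measure.smul_apply, smul_eq_mul, ENNReal.inv_mul_cancel]
    · rw [Measure.measure_univ_ne_zero]
      exact Measure.toSphere_ne_zero (volume : Measure E)
    · exact measure_ne_top _ _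
  exact Measure.isProbabilityMeasure_map measurable_subtype_coe.aemeasurable

theorem uniformSphere_ae_norm (E : Type) [NormedAddCommGroup E] [InnerProductSpace ℝ E]
    [FiniteDimensional ℝ E] [MeasurableSpace E] [BorelSpace E] :
    ∀ᵐ x ∂(uniformSphere E), ‖x‖ = 1 := by
  unfold uniformSphere
  rw [ae_map_iff measurable_subtype_coe.aemeasurable
    (measurableSet_eq_fun continuous_norm.measurable measurable_const)]
  exact Filter.Eventually.of_forall fun x => by simp

-- Surface measure is read off from the volume of the cone over the set. Isometries carry cones to
-- cones and preserve volume, which yields invariance.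
open scoped Pointwise in
theorem uniformSphere_apply {S : Set E} (hS : MeasurableSet S) :
    uniformSphere E S = ((volume : Measure E).toSphere Set.univ)⁻¹ *
      (Module.finrank ℝ E * volume (Set.Ioo (0 : ℝ) 1 • (S ∩ Metric.sphere (0 : E) 1))) := by
  unfold uniformSphere
  rw [Measure.map_apply measurable_subtype_coe hS, Measure.smul_apply, smul_eq_mul,
    Measure.toSphere_apply' _ (measurable_subtype_coe hS), Subtype.image_preimage_coe,
    Set.inter_comm]

open scoped Pointwise in
/-- The uniform measure on the sphere is invariant under linear isometries. -/
theorem measurePreserving_uniformSphere (g : E ≃ₗᵢ[ℝ] E) :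
    MeasurePreserving g (uniformSphere E) (uniformSphere E) := by
  refine ⟨g.continuous.measurable, ?_⟩
  ext S hS
  rw [Measure.map_apply g.continuous.measurable hS,
    uniformSphere_apply (g.continuous.measurable hS), uniformSphere_apply hS]
  congr 2
  have hv : MeasurePreserving g.toHomeomorph.toMeasurableEquiv (volume : Measure E) volume :=
    g.measurePreserving
  refine Eq.trans ?_ (hv.measure_preimage_equiv _)
  congr 1
  ext x
  simp only [Homeomorph.toMeasurableEquiv_coe, LinearIsometryEquiv.coe_toHomeomorph,
    Set.mem_smul, Set.mem_inter_iff, Set.mem_preimage, mem_sphere_zero_iff_norm]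
  constructor
  · rintro ⟨r, hr, y, ⟨hy, hn⟩, rfl⟩
    exact ⟨r, hr, g y, ⟨hy, by simpa using hn⟩, by simp⟩
  · rintro ⟨r, hr, y, ⟨hy, hn⟩, h⟩
    refine ⟨r, hr, g.symm y, ⟨by simpa using hy, by simpa using hn⟩, ?_⟩
    apply g.injective
    simpa using h

theorem integrable_uniformSphere [Nontrivial E] {f : E → ℝ} (hf : Continuous f) :
    Integrable f (uniformSphere E) := by
  obtain ⟨C, hC⟩ := (isCompact_sphere (0 : E) 1).exists_bound_of_continuousOn hf.continuousOn
  refine Integrable.of_bound hf.aestronglyMeasurable C ?_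
  filter_upwards [uniformSphere_ae_norm E] with x hx
  exact hC x (by simpa using hx)

theorem integrable_uniformSphere_prod [Nontrivial E] {f : E × E → ℝ} (hf : Continuous f) :
    Integrable f ((uniformSphere E).prod (uniformSphere E)) := by
  obtain ⟨C, hC⟩ := ((isCompact_sphere (0 : E) 1).prod
    (isCompact_sphere (0 : E) 1)).exists_bound_of_continuousOn hf.continuousOn
  have : SecondCountableTopology E := secondCountable_of_proper
  refine Integrable.of_bound hf.aestronglyMeasurable C ?_
  have h1 := Measure.quasiMeasurePreserving_fst (μ := uniformSphere E) (ν := uniformSphere E)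
    |>.ae (uniformSphere_ae_norm E)
  have h2 := Measure.quasiMeasurePreserving_snd (μ := uniformSphere E) (ν := uniformSphere E)
    |>.ae (uniformSphere_ae_norm E)
  filter_upwards [h1, h2] with x hx hy
  exact hC x (by simp [hx, hy])

/-- The moments of a linear functional depend only on its norm. -/
theorem integral_inner_pow_eq (k : ℕ) {a b : E} (h : ‖a‖ = ‖b‖) :
    ∫ x, (inner ℝ a x) ^ k ∂(uniformSphere E) = ∫ x, (inner ℝ b x) ^ k ∂(uniformSphere E) := by
  -- The reflection in the hyperplane orthogonal to `a - b` exchanges two vectors of equal norm.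
  set g := (Submodule.span ℝ {a - b})ᗮ.reflection with hg
  have hga : g a = b := Submodule.reflection_sub h
  rw [← (measurePreserving_uniformSphere g).integral_comp
    g.toHomeomorph.measurableEmbedding (fun x => (inner ℝ b x) ^ k)]
  refine integral_congr_ae (Filter.Eventually.of_forall fun x => ?_)
  simp only
  rw [← hga, LinearIsometryEquiv.inner_map_map]

theorem exists_integral_inner_pow (k : ℕ) [Nontrivial E] :
    ∃ C : ℝ, ∀ a : E, ∫ x, (inner ℝ a x) ^ k ∂(uniformSphere E) = C * ‖a‖ ^ k := by
  obtain ⟨e, he⟩ := exists_norm_eq (E := E) zero_le_one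
  refine ⟨∫ x, (inner ℝ e x) ^ k ∂(uniformSphere E), fun a => ?_⟩
  rw [integral_inner_pow_eq k (a := a) (b := ‖a‖ • e) (by simp [norm_smul, he])]
  simp_rw [real_inner_smul_left, mul_pow]
  rw [integral_const_mul, mul_comm]

theorem sum_inner_mul_self {E I : Type} [NormedAddCommGroup E] [InnerProductSpace ℝ E]
    [Fintype I] (b : OrthonormalBasis I ℝ E) (x : E) : ∑ i, inner ℝ (b i) x * inner ℝ (b i) x = ‖x‖ ^ 2 := by
  rw [← OrthonormalBasis.sum_sq_norm_inner_right b x]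
  simp [pow_two]

/-- Second moments of the uniform distribution on the sphere. -/
theorem integral_inner_mul_inner [Nontrivial E] (u v : E) :
    ∫ x, inner ℝ u x * inner ℝ v x ∂(uniformSphere E) =
      inner ℝ u v / (Module.finrank ℝ E) := by
  obtain ⟨C, hC⟩ := exists_integral_inner_pow (E := E) 2
  have key : ∀ u v : E, ∫ x, inner ℝ u x * inner ℝ v x ∂(uniformSphere E) = C * inner ℝ u v := by
    intro u v
    have h : ∀ x : E, inner ℝ u x * inner ℝ v x =
        (1 / 4 : ℝ) * (inner ℝ (u + v) x ^ 2) - (1 / 4 : ℝ) * (inner ℝ (u - v) x ^ 2) := by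
      intro x; rw [inner_add_left, inner_sub_left]; ring
    simp_rw [h]
    rw [integral_sub, integral_const_mul, integral_const_mul, hC, hC, norm_add_sq_real,
      norm_sub_sq_real]
    · ring
    all_goals exact integrable_uniformSphere (by fun_prop)
  obtain ⟨b, -⟩ : ∃ b, b = stdOrthonormalBasis ℝ E := ⟨_, rfl⟩
  have h1 : ∫ x, ∑ i, inner ℝ (b i) x * inner ℝ (b i) x ∂(uniformSphere E) = 1 := by
    have : (fun x : E => ∑ i, inner ℝ (b i) x * inner ℝ (b i) x) =ᵐ[uniformSphere E]
        fun _ => 1 := by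
      filter_upwards [uniformSphere_ae_norm E] with x hx
      rw [sum_inner_mul_self, hx, one_pow]
    rw [integral_congr_ae this]; simp
  rw [integral_finsetSum _ (fun i _ => integrable_uniformSphere (by fun_prop))] at h1
  simp only [key, real_inner_self_eq_norm_sq, OrthonormalBasis.norm_eq_one, one_pow, mul_one,
    Finset.sum_const, Finset.card_univ, Fintype.card_fin, nsmul_eq_mul] at h1
  have hn : (Module.finrank ℝ E : ℝ) ≠ 0 := by
    intro h0; rw [h0] at h1; simp at h1
  rw [key, eq_div_iff hn]
  linear_combination inner ℝ u v * h1

/-- Fourth moments of the uniform distribution on the sphere. -/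
theorem integral_inner_mul_inner_mul_inner_mul_inner [Nontrivial E] (u v w z : E) :
    ∫ x, inner ℝ u x * inner ℝ v x * inner ℝ w x * inner ℝ z x ∂(uniformSphere E) =
      (inner ℝ u v * inner ℝ w z + inner ℝ u w * inner ℝ v z + inner ℝ u z * inner ℝ v w) /
        (Module.finrank ℝ E * (Module.finrank ℝ E + 2)) := by
  obtain ⟨C, hC⟩ := exists_integral_inner_pow (E := E) 4
  have key : ∀ u v w z : E,
      ∫ x, inner ℝ u x * inner ℝ v x * inner ℝ w x * inner ℝ z x ∂(uniformSphere E) =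
      C / 3 * (inner ℝ u v * inner ℝ w z + inner ℝ u w * inner ℝ v z
        + inner ℝ u z * inner ℝ v w) := by
    intro u v w z
    have hn4 : ∀ a : E, ‖a‖ ^ 4 = (inner ℝ a a) ^ 2 := by
      intro a; rw [real_inner_self_eq_norm_sq]; ring
    -- Polarization of a quartic form over the eight sign choices for `v`, `w`, `z`; `192 = 2³ ·
    -- 4!`.
    have h : ∀ x : E, inner ℝ u x * inner ℝ v x * inner ℝ w x * inner ℝ z x =
        (1 / 192 : ℝ) * ((inner ℝ (u + v + w + z) x ^ 4 - inner ℝ (u + v + w - z) x ^ 4)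
        - (inner ℝ (u + v - w + z) x ^ 4 - inner ℝ (u + v - w - z) x ^ 4)
        - (inner ℝ (u - v + w + z) x ^ 4 - inner ℝ (u - v + w - z) x ^ 4)
        + (inner ℝ (u - v - w + z) x ^ 4 - inner ℝ (u - v - w - z) x ^ 4)) := by
      intro x; simp only [inner_add_left, inner_sub_left]; ring
    simp_rw [h]
    rw [integral_const_mul, integral_add, integral_sub, integral_sub, integral_sub, integral_sub,
      integral_sub, integral_sub]
    · simp only [hC]
      simp only [hn4, inner_add_left, inner_sub_left, inner_add_right, inner_sub_right,
        real_inner_comm u v, real_inner_comm u w, real_inner_comm u z, real_inner_comm v w,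
        real_inner_comm v z, real_inner_comm w z]
      ring
    all_goals exact integrable_uniformSphere (by fun_prop)
  obtain ⟨b, -⟩ : ∃ b, b = stdOrthonormalBasis ℝ E := ⟨_, rfl⟩
  -- Integrating `‖x‖⁴ = 1` over the sphere fixes the constant: the three pairings sum to `n² + 2n`.
  have h1 : ∫ x, ∑ i, ∑ j, inner ℝ (b i) x * inner ℝ (b i) x * inner ℝ (b j) x *
      inner ℝ (b j) x ∂(uniformSphere E) = 1 := by
    have : (fun x : E => ∑ i, ∑ j, inner ℝ (b i) x * inner ℝ (b i) x * inner ℝ (b j) x *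
      inner ℝ (b j) x) =ᵐ[uniformSphere E] fun _ => 1 := by
      filter_upwards [uniformSphere_ae_norm E] with x hx
      have h2 := congrArg₂ (· * ·) (sum_inner_mul_self b x) (sum_inner_mul_self b x)
      simp only [Finset.sum_mul_sum, hx, one_pow, mul_one, ← mul_assoc] at h2
      exact h2
    rw [integral_congr_ae this]; simp
  rw [integral_finsetSum _ (fun i _ => integrable_uniformSphere (by fun_prop))] at h1
  have h2 : ∀ i, ∫ x, ∑ j, inner ℝ (b i) x * inner ℝ (b i) x * inner ℝ (b j) x *
      inner ℝ (b j) x ∂(uniformSphere E) = ∑ j, ∫ x, inner ℝ (b i) x * inner ℝ (b i) x *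
      inner ℝ (b j) x * inner ℝ (b j) x ∂(uniformSphere E) := fun i =>
    integral_finsetSum _ (fun j _ => integrable_uniformSphere (by fun_prop))
  simp only [h2] at h1
  simp only [key, OrthonormalBasis.inner_eq_ite, ← Finset.mul_sum, Finset.sum_add_distrib] at h1
  simp at h1
  have hn : (Module.finrank ℝ E : ℝ) ≠ 0 := by
    intro h0; rw [h0] at h1; simp at h1
  rw [key, eq_div_iff (by positivity)]
  linear_combination (inner ℝ u v * inner ℝ w z + inner ℝ u w * inner ℝ v z
    + inner ℝ u z * inner ℝ v w) * h1

end Sphere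

/-! ### Pairing formulas for linear and quadratic vector-valued maps -/

section Wick

variable {E G I : Type} [NormedAddCommGroup E] [InnerProductSpace ℝ E]
  [FiniteDimensional ℝ E] [MeasurableSpace E] [BorelSpace E] [Nontrivial E]
  [NormedAddCommGroup G] [InnerProductSpace ℝ G] [Fintype I]

theorem integral_norm_sq_of_linear (b : OrthonormalBasis I ℝ E) {f : E → G} (A : I → G)
    (hf : ∀ x, f x = ∑ α, (inner ℝ (b α) x : ℝ) • A α) :
    ∫ x, ‖f x‖ ^ 2 ∂(uniformSphere E) = (∑ α, ‖A α‖ ^ 2) / Module.finrank ℝ E := by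
  classical
  have h : ∀ x, ‖f x‖ ^ 2 = ∑ α, ∑ γ, (inner ℝ (A α) (A γ) : ℝ) *
      (inner ℝ (b α) x * inner ℝ (b γ) x) := by
    intro x
    rw [hf, ← real_inner_self_eq_norm_sq, sum_inner]
    simp only [inner_sum, real_inner_smul_left, real_inner_smul_right]
    exact Finset.sum_congr rfl fun _ _ => Finset.sum_congr rfl fun _ _ => by ring
  simp only [h]
  rw [integral_finsetSum _ (fun i _ => integrable_uniformSphere (by fun_prop)), Finset.sum_div]
  refine Finset.sum_congr rfl fun α _ => ?_
  rw [integral_finsetSum _ (fun i _ => integrable_uniformSphere (by fun_prop))]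
  simp only [integral_const_mul, integral_inner_mul_inner, OrthonormalBasis.inner_eq_ite]
  rw [Finset.sum_eq_single α]
  · simp [div_eq_mul_inv]
  · intro γ _ hγ; simp [Ne.symm hγ]
  · simp

/-- The three terms are the three pairings of the indices in `⟪A α γ, A δ ε⟫`: `α = γ, δ = ε`, then
`α = δ, γ = ε`, then `α = ε, γ = δ`. -/
theorem integral_norm_sq_of_quadratic (b : OrthonormalBasis I ℝ E) {f : E → G} (A : I → I → G)
    (hf : ∀ x, f x = ∑ α, ∑ γ, (inner ℝ (b α) x * inner ℝ (b γ) x : ℝ) • A α γ) :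
    ∫ x, ‖f x‖ ^ 2 ∂(uniformSphere E) =
      (‖∑ α, A α α‖ ^ 2 + ∑ α, ∑ γ, ‖A α γ‖ ^ 2 + ∑ α, ∑ γ, inner ℝ (A α γ) (A γ α)) /
        (Module.finrank ℝ E * (Module.finrank ℝ E + 2)) := by
  classical
  have h : ∀ x, ‖f x‖ ^ 2 = ∑ α, ∑ γ, ∑ δ, ∑ ε, (inner ℝ (A α γ) (A δ ε) : ℝ) *
      (inner ℝ (b α) x * inner ℝ (b γ) x * inner ℝ (b δ) x * inner ℝ (b ε) x) := by
    intro x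
    rw [hf, ← real_inner_self_eq_norm_sq]
    simp only [sum_inner]
    simp only [inner_sum, real_inner_smul_left, real_inner_smul_right]
    exact Finset.sum_congr rfl fun _ _ => Finset.sum_congr rfl fun _ _ =>
      Finset.sum_congr rfl fun _ _ => Finset.sum_congr rfl fun _ _ => by ring
  have h4 : ∀ α γ δ ε, ∫ x, (inner ℝ (A α γ) (A δ ε) : ℝ) *
      (inner ℝ (b α) x * inner ℝ (b γ) x * inner ℝ (b δ) x * inner ℝ (b ε) x)
        ∂(uniformSphere E) = ((if α = γ then if δ = ε then inner ℝ (A α γ) (A δ ε) else 0 else 0) +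
        (if α = δ then if γ = ε then inner ℝ (A α γ) (A δ ε) else 0 else 0) +
        (if α = ε then if γ = δ then inner ℝ (A α γ) (A δ ε) else 0 else 0)) /
        (Module.finrank ℝ E * (Module.finrank ℝ E + 2)) := by
    intro α γ δ ε
    rw [integral_const_mul, integral_inner_mul_inner_mul_inner_mul_inner, ← mul_div_assoc]
    simp only [OrthonormalBasis.inner_eq_ite]
    congr 1
    split_ifs <;> simp only [mul_one, mul_zero, add_zero, zero_add] <;> ring
  have hint : ∫ x, ‖f x‖ ^ 2 ∂(uniformSphere E) = ∑ α, ∑ γ, ∑ δ, ∑ ε,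
      ∫ x, (inner ℝ (A α γ) (A δ ε) : ℝ) *
      (inner ℝ (b α) x * inner ℝ (b γ) x * inner ℝ (b δ) x * inner ℝ (b ε) x)
        ∂(uniformSphere E) := by
    simp only [h]
    rw [integral_finsetSum _ (fun i _ => integrable_uniformSphere (by fun_prop))]
    refine Finset.sum_congr rfl fun α _ => ?_
    rw [integral_finsetSum _ (fun i _ => integrable_uniformSphere (by fun_prop))]
    refine Finset.sum_congr rfl fun γ _ => ?_
    rw [integral_finsetSum _ (fun i _ => integrable_uniformSphere (by fun_prop))]
    refine Finset.sum_congr rfl fun δ _ => ?_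
    rw [integral_finsetSum _ (fun i _ => integrable_uniformSphere (by fun_prop))]
  rw [hint]
  simp only [h4, ← Finset.sum_div, Finset.sum_add_distrib]
  refine congrArg₂ _ (congrArg₂ _ (congrArg₂ _ ?_ ?_) ?_) rfl
  · rw [← real_inner_self_eq_norm_sq, sum_inner]
    simp only [inner_sum]
    refine Finset.sum_congr rfl fun α _ => ?_
    rw [Finset.sum_eq_single α]
    · simp
    · intro γ _ hγ; simp [Ne.symm hγ]
    · simp
  · refine Finset.sum_congr rfl fun α _ => Finset.sum_congr rfl fun γ _ => ?_
    rw [Finset.sum_eq_single α]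
    · simp
    · intro γ _ hγ; simp [Ne.symm hγ]
    · simp
  · refine Finset.sum_congr rfl fun α _ => Finset.sum_congr rfl fun γ _ => ?_
    rw [Finset.sum_eq_single γ]
    · simp
    · intro γ _ hγ; simp [Ne.symm hγ]
    · simp

end Wick

/-- An orthonormal basis of a normed `*`-ring over the reals with multiplicative norm, together
with the two identities that determine the fourth moments of matrices over it. -/
structure CompositionBasis (F : Type) [NormedRing F] [StarRing F] [InnerProductSpace ℝ F]
    (β : ℕ) where
  e : OrthonormalBasis (Fin β) ℝ F
  norm_mul : ∀ x y : F, ‖x * y‖ = ‖x‖ * ‖y‖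
  mul_star : ∀ x : F, x * star x = (‖x‖ ^ 2) • (1 : F)
  sum_inner_star : ∀ x : F, ∑ p, ∑ q, (inner ℝ (e p * x * star (e q))
    (star (e p * x * star (e q))) : ℝ) = (2 * β - (β : ℝ) ^ 2) * ‖x‖ ^ 2

/-! ### Averages of `u V` and `u B u†` over `u` for fixed `V`, `B` -/

section Matrices

variable {F : Type} [NormedRing F] [InnerProductSpace ℝ F] {β d : ℕ}

/-- The orthonormal basis of `F^(d²)` made of multiples of matrix units. -/
def twoSiteBasis (e : OrthonormalBasis (Fin β) ℝ F) (d : ℕ) :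
    OrthonormalBasis ((_ : Fin d × Fin d) × Fin β) ℝ (TwoSite F d) :=
  Pi.orthonormalBasis fun _ => e

theorem twoSiteBasis_apply (e : OrthonormalBasis (Fin β) ℝ F)
    (α : (_ : Fin d × Fin d) × Fin β) (ij : Fin d × Fin d) :
    twoSiteBasis e d α ij = if α.1 = ij then e α.2 else 0 := by
  unfold twoSiteBasis
  rw [Pi.orthonormalBasis_apply]
  by_cases h : α.1 = ij
  · subst h; simp
  · simp [h]

theorem twoSite_coord (e : OrthonormalBasis (Fin β) ℝ F) (x : TwoSite F d) (ij : Fin d × Fin d) :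
    x ij = ∑ α, (inner ℝ (twoSiteBasis e d α) x : ℝ) • twoSiteBasis e d α ij := by
  conv_lhs => rw [← (twoSiteBasis e d).sum_repr' x]
  simp

theorem finrank_twoSite (e : OrthonormalBasis (Fin β) ℝ F) (d : ℕ) :
    Module.finrank ℝ (TwoSite F d) = d * d * β := by
  rw [Module.finrank_eq_card_basis (twoSiteBasis e d).toBasis]
  simp

/-- The entry `(k, l)` of `u B u†` involves only rows `k` and `l` of `u`, so its coefficients vanish
off these rows. -/
theorem sum_eq_sum_row {M : Type} [AddCommMonoid M] (k : Fin d)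
    (g : ((_ : Fin d × Fin d) × Fin β) → M) (h : ∀ α, α.1.1 ≠ k → g α = 0) :
    ∑ α, g α = ∑ j, ∑ p, g ⟨(k, j), p⟩ := by
  rw [Fintype.sum_sigma, Fintype.sum_prod_type, Finset.sum_eq_single k]
  · intro m _ hm
    exact Finset.sum_eq_zero fun j _ => Finset.sum_eq_zero fun p _ => h _ hm
  · simp

variable [StarRing F] [IsScalarTower ℝ F F] [FiniteDimensional ℝ F]
  [MeasurableSpace (TwoSite F d)] [BorelSpace (TwoSite F d)]

theorem integral_frobSq_mul [Nontrivial (TwoSite F d)] (c : CompositionBasis F β)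
    (V : Matrix (Fin d) (Fin d) F) :
    ∫ x, frobSq (reshape x * V) ∂(uniformSphere (TwoSite F d)) =
      d * β * frobSq V / (d * d * β) := by
  have h1 : ∀ i j, ∫ x, ‖(reshape x * V) i j‖ ^ 2 ∂(uniformSphere (TwoSite F d)) =
      (∑ k, β * ‖V k j‖ ^ 2) / (d * d * β) := by
    intro i j
    rw [integral_norm_sq_of_linear (twoSiteBasis c.e d)
      (fun α => ∑ k, twoSiteBasis c.e d α (i, k) * V k j), finrank_twoSite c.e]
    · push_cast
      congr 1
      rw [Fintype.sum_sigma, Fintype.sum_prod_type, Finset.sum_eq_single i]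
      · refine Finset.sum_congr rfl fun k _ => ?_
        simp [twoSiteBasis_apply, c.norm_mul]
      · intro k _ hk
        simp [twoSiteBasis_apply, hk]
      · simp
    · intro x
      simp only [Matrix.mul_apply, reshape, Matrix.of_apply, Finset.smul_sum]
      rw [Finset.sum_comm]
      refine Finset.sum_congr rfl fun k _ => ?_
      rw [twoSite_coord c.e x (i, k), Finset.sum_mul]
      simp [smul_mul_assoc]
  have hc : ∀ i j, Continuous fun x : TwoSite F d => ‖(reshape x * V) i j‖ ^ 2 := by
    intro i j
    simp only [Matrix.mul_apply, reshape, Matrix.of_apply]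
    fun_prop
  unfold frobSq
  rw [integral_finsetSum _ (fun i _ => integrable_uniformSphere
    (continuous_finsetSum _ fun j _ => hc i j))]
  simp_rw [integral_finsetSum Finset.univ (fun j _ => integrable_uniformSphere (hc _ j)), h1,
    ← Finset.sum_div, ← Finset.mul_sum]
  rw [Finset.sum_const, Finset.sum_comm]
  simp only [Finset.card_univ, Fintype.card_fin, nsmul_eq_mul]
  ring

variable [NormOneClass F] [NormedStarGroup F] [SMulCommClass ℝ F F] [StarModule ℝ F]

/-- The first and third pairings need `k = l` and so occur `d` times; the second occurs for all `d²`
entries. Real diagonal entries of `B` are what lets `e p * B i i * star (e p)` collapse to the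
scalar `t i`. -/
theorem integral_frobSq_conj [Nontrivial (TwoSite F d)] (c : CompositionBasis F β)
    (B : Matrix (Fin d) (Fin d) F) (hB : B.IsHermitian) (t : Fin d → ℝ)
    (ht : ∀ i, B i i = t i • (1 : F)) :
    ∫ x, frobSq (reshape x * B * (reshape x)ᴴ) ∂(uniformSphere (TwoSite F d)) =
      (d * (β * ∑ i, t i) ^ 2 + d ^ 2 * β ^ 2 * frobSq B + d * (2 * β - β ^ 2) * frobSq B) /
        (d * d * β * (d * d * β + 2)) := by
  set A : Fin d → Fin d → ((_ : Fin d × Fin d) × Fin β) → ((_ : Fin d × Fin d) × Fin β) → F :=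
    fun k l α γ => if α.1.1 = k then if γ.1.1 = l then
      c.e α.2 * B α.1.2 γ.1.2 * star (c.e γ.2) else 0 else 0 with hA
  have hn : ∀ p, ‖c.e p‖ = 1 := fun p => c.e.norm_eq_one p
  have h1 : ∀ k l, ∫ x, ‖(reshape x * B * (reshape x)ᴴ) k l‖ ^ 2
      ∂(uniformSphere (TwoSite F d)) = ((if k = l then (β * ∑ i, t i) ^ 2 else 0) +
        β ^ 2 * frobSq B + (if k = l then (2 * β - β ^ 2) * frobSq B else 0)) /
        (d * d * β * (d * d * β + 2)) := by
    intro k l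
    rw [integral_norm_sq_of_quadratic (twoSiteBasis c.e d) (A k l), finrank_twoSite c.e]
    · push_cast
      congr 3
      -- Pairing `u` with `u†` contracts `B` to `β` times its trace.
      · have : ∑ α, A k l α α = if k = l then ((β : ℝ) * ∑ i, t i) • (1 : F) else 0 := by
          rw [sum_eq_sum_row k _ (fun α hα => by simp [hA, hα])]
          simp only [hA, if_true]
          split_ifs with h
          · simp [ht, mul_smul_comm, smul_mul_assoc, c.mul_star, hn, Finset.mul_sum,
              Finset.sum_smul, mul_smul]
            exact Finset.sum_congr rfl fun i _ => by
              rw [smul_comm, Nat.cast_smul_eq_nsmul, nsmul_one]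
          · simp
        rw [this]
        split_ifs <;> simp [norm_smul, mul_pow]
      · rw [sum_eq_sum_row k _ (fun α hα => by simp [hA, hα])]
        have : ∀ i p, ∑ γ, ‖A k l ⟨(k, i), p⟩ γ‖ ^ 2 = ∑ j, β * ‖B i j‖ ^ 2 := by
          intro i p
          rw [sum_eq_sum_row l _ (fun α hα => by simp [hA, hα])]
          simp [hA, c.norm_mul, hn]
        simp only [this, frobSq, Finset.mul_sum, Finset.sum_const, Finset.card_univ,
          Fintype.card_fin, nsmul_eq_mul]
        exact Finset.sum_congr rfl fun _ _ => Finset.sum_congr rfl fun _ _ => by ring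
      · split_ifs with h
        · subst h
          rw [sum_eq_sum_row k _ (fun α hα => by simp [hA, hα])]
          -- Since `B` is Hermitian, exchanging the two indices of a coefficient conjugates it,
          -- which puts the sum in the form of `sum_inner_star`.
          have h2 : ∀ i p, ∑ γ, inner ℝ (A k k ⟨(k, i), p⟩ γ) (A k k γ ⟨(k, i), p⟩) =
              ∑ j, ∑ q, inner ℝ (c.e p * B i j * star (c.e q))
                (star (c.e p * B i j * star (c.e q))) := by
            intro i p
            rw [sum_eq_sum_row k _ (fun α hα => by simp [hA, hα])]
            refine Finset.sum_congr rfl fun j _ => Finset.sum_congr rfl fun q _ => ?_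
            simp only [hA, if_true, star_mul, star_star, ← hB.apply j i, mul_assoc]
          simp only [h2, frobSq, Finset.mul_sum]
          refine Finset.sum_congr rfl fun i _ => ?_
          rw [Finset.sum_comm]
          exact Finset.sum_congr rfl fun j _ => c.sum_inner_star _
        · refine Finset.sum_eq_zero fun α _ => Finset.sum_eq_zero fun γ _ => ?_
          simp only [hA]
          split_ifs <;> simp_all
    · intro x
      have hr : ∀ i j, x (k, i) * B i j * star (x (l, j)) = ∑ α, ∑ γ,
          (inner ℝ (twoSiteBasis c.e d α) x * inner ℝ (twoSiteBasis c.e d γ) x : ℝ) •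
          (twoSiteBasis c.e d α (k, i) * B i j * star (twoSiteBasis c.e d γ (l, j))) := by
        intro i j
        conv_lhs => rw [twoSite_coord c.e x (k, i), twoSite_coord c.e x (l, j)]
        rw [star_sum, Finset.sum_mul, Finset.sum_mul_sum]
        refine Finset.sum_congr rfl fun α _ => Finset.sum_congr rfl fun γ _ => ?_
        simp only [star_smul, star_trivial, smul_mul_assoc, mul_smul_comm, smul_smul]
        rw [mul_comm]
      have hA' : ∀ α γ, A k l α γ = ∑ j, ∑ i,
          twoSiteBasis c.e d α (k, i) * B i j * star (twoSiteBasis c.e d γ (l, j)) := by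
        intro α γ
        obtain ⟨⟨a, i⟩, p⟩ := α
        obtain ⟨⟨a', j⟩, q⟩ := γ
        rw [Finset.sum_eq_single j, Finset.sum_eq_single i]
        · simp only [twoSiteBasis_apply, hA, Prod.mk.injEq, and_true]
          split_ifs <;> simp
        · intro m _ hm; simp [twoSiteBasis_apply, hm.symm]
        · simp
        · intro m _ hm; simp [twoSiteBasis_apply, hm.symm]
        · simp
      simp only [Matrix.mul_apply, reshape, Matrix.of_apply, Matrix.conjTranspose_apply,
        Finset.sum_mul, hr, hA', Finset.smul_sum]
      rw [Finset.sum_congr rfl fun j _ => Finset.sum_comm]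
      rw [Finset.sum_comm]
      refine Finset.sum_congr rfl fun α _ => ?_
      rw [Finset.sum_congr rfl fun j _ => Finset.sum_comm]
      rw [Finset.sum_comm]
  have hc : ∀ i j, Continuous fun x : TwoSite F d =>
      ‖(reshape x * B * (reshape x)ᴴ) i j‖ ^ 2 := by
    intro i j
    simp only [Matrix.mul_apply, reshape, Matrix.of_apply, Matrix.conjTranspose_apply]
    fun_prop
  unfold frobSq
  rw [integral_finsetSum _ (fun i _ => integrable_uniformSphere
    (continuous_finsetSum _ fun j _ => hc i j))]
  simp_rw [integral_finsetSum Finset.univ (fun j _ => integrable_uniformSphere (hc _ j)), h1,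
    ← Finset.sum_div]
  congr 1
  simp only [Finset.sum_add_distrib]
  simp [frobSq]
  ring

end Matrices

/-! ### Averaging over both factors, and transfer to random variables -/

section Means

variable {F : Type} [NormedRing F] {β d : ℕ}

theorem continuous_frobSq_mul :
    Continuous fun z : TwoSite F d × TwoSite F d => frobSq (reshape z.1 * reshape z.2) := by
  simp only [frobSq, Matrix.mul_apply, reshape, Matrix.of_apply]
  fun_prop

theorem frobSq_reshape (x : TwoSite F d) : frobSq (reshape x) = ‖x‖ ^ 2 := by
  rw [PiLp.norm_sq_eq_of_L2, Fintype.sum_prod_type]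
  rfl

variable [StarRing F]

theorem continuous_frobSq_mul_conj [NormedStarGroup F] :
    Continuous fun z : TwoSite F d × TwoSite F d =>
      frobSq ((reshape z.1 * reshape z.2) * (reshape z.1 * reshape z.2)ᴴ) := by
  simp only [frobSq, Matrix.mul_apply, reshape, Matrix.of_apply, Matrix.conjTranspose_apply]
  fun_prop

variable [InnerProductSpace ℝ F]

theorem CompositionBasis.mul_conjTranspose_apply_self (c : CompositionBasis F β)
    (V : Matrix (Fin d) (Fin d) F) (i : Fin d) :
    (V * Vᴴ) i i = (∑ j, ‖V i j‖ ^ 2) • (1 : F) := by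
  simp [Matrix.mul_apply, c.mul_star, Finset.sum_smul]

variable [IsScalarTower ℝ F F] [FiniteDimensional ℝ F]
  [MeasurableSpace (TwoSite F d)] [BorelSpace (TwoSite F d)]

theorem integral_frobSq_sphere_prod [Nontrivial (TwoSite F d)]
    (c : CompositionBasis F β) (hβ : β ≠ 0) (hd : d ≠ 0) :
    ∫ z, frobSq (reshape z.1 * reshape z.2)
      ∂((uniformSphere (TwoSite F d)).prod (uniformSphere (TwoSite F d))) = 1 / d := by
  have hβ' : (β : ℝ) ≠ 0 := by exact_mod_cast hβ
  have hd' : (d : ℝ) ≠ 0 := by exact_mod_cast hd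
  -- Fubini with `v` outermost: the inner integral over `u` sees a fixed matrix.
  have hi := integral_prod_symm _
    (integrable_uniformSphere_prod (E := TwoSite F d) continuous_frobSq_mul)
  rw [hi]
  simp only [integral_frobSq_mul c, frobSq_reshape]
  have : (fun y : TwoSite F d => d * β * ‖y‖ ^ 2 / (d * d * β)) =ᵐ[uniformSphere (TwoSite F d)]
      fun _ => 1 / (d : ℝ) := by
    filter_upwards [uniformSphere_ae_norm (TwoSite F d)] with y hy
    rw [hy]; field_simp
  rw [integral_congr_ae this]
  simp

variable [NormOneClass F] [NormedStarGroup F] [SMulCommClass ℝ F F] [StarModule ℝ F]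

/-- The mean purity of a uniformly distributed unit vector. -/
theorem integral_frobSq_mul_conjTranspose [Nontrivial (TwoSite F d)]
    (c : CompositionBasis F β) (hβ : β ≠ 0) (hd : d ≠ 0) :
    ∫ x, frobSq (reshape x * (reshape x)ᴴ) ∂(uniformSphere (TwoSite F d)) =
      (2 * β * d - β + 2) / (β * d ^ 2 + 2) := by
  have h := integral_frobSq_conj c (1 : Matrix (Fin d) (Fin d) F) Matrix.isHermitian_one
    (fun _ => 1) (by simp)
  have h1 : frobSq (1 : Matrix (Fin d) (Fin d) F) = d := by
    simp [frobSq, Matrix.one_apply, apply_ite]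
  simp only [mul_one, h1] at h
  rw [h]
  have hβ' : (β : ℝ) ≠ 0 := by exact_mod_cast hβ
  have hd' : (d : ℝ) ≠ 0 := by exact_mod_cast hd
  have : (d : ℝ) * d * β + 2 ≠ 0 := by positivity
  have : (β : ℝ) * d ^ 2 + 2 ≠ 0 := by positivity
  simp
  field_simp
  ring

/-- The average over `u` with `B = v v†` is affine in the purity of `v`, because the trace of `B` is
`‖v‖² = 1`. The mean purity then finishes the computation. -/
theorem integral_frobSq_conj_sphere_prod [Nontrivial (TwoSite F d)]
    (c : CompositionBasis F β) (hβ : β ≠ 0) (hd : d ≠ 0) :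
    ∫ z, frobSq ((reshape z.1 * reshape z.2) * (reshape z.1 * reshape z.2)ᴴ)
      ∂((uniformSphere (TwoSite F d)).prod (uniformSphere (TwoSite F d))) =
      quarticValue β d := by
  have hβ' : (β : ℝ) ≠ 0 := by exact_mod_cast hβ
  have hd' : (d : ℝ) ≠ 0 := by exact_mod_cast hd
  have hi := integral_prod_symm _
    (integrable_uniformSphere_prod (E := TwoSite F d) continuous_frobSq_mul_conj)
  rw [hi]
  have h1 : ∀ U V : Matrix (Fin d) (Fin d) F, U * V * (U * V)ᴴ = U * (V * Vᴴ) * Uᴴ := by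
    intro U V; rw [Matrix.conjTranspose_mul]; simp only [Matrix.mul_assoc]
  have h2 : ∀ V : Matrix (Fin d) (Fin d) F,
      ∫ x, frobSq (reshape x * (V * Vᴴ) * (reshape x)ᴴ) ∂(uniformSphere (TwoSite F d)) =
      (d * (β * frobSq V) ^ 2 + d ^ 2 * β ^ 2 * frobSq (V * Vᴴ) +
        d * (2 * β - β ^ 2) * frobSq (V * Vᴴ)) / (d * d * β * (d * d * β + 2)) := fun V =>
    integral_frobSq_conj c (V * Vᴴ) (Matrix.isHermitian_mul_conjTranspose_self V) _
      (c.mul_conjTranspose_apply_self V)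
  simp only [h1, h2, frobSq_reshape]
  have h3 : (fun y : TwoSite F d => (d * (β * ‖y‖ ^ 2) ^ 2 +
      d ^ 2 * β ^ 2 * frobSq (reshape y * (reshape y)ᴴ) +
        d * (2 * β - β ^ 2) * frobSq (reshape y * (reshape y)ᴴ)) /
          (d * d * β * (d * d * β + 2))) =ᵐ[uniformSphere (TwoSite F d)]
      fun y => d * β ^ 2 / (d * d * β * (d * d * β + 2) : ℝ) +
        (d ^ 2 * β ^ 2 + d * (2 * β - β ^ 2)) / (d * d * β * (d * d * β + 2)) *
          frobSq (reshape y * (reshape y)ᴴ) := by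
    filter_upwards [uniformSphere_ae_norm (TwoSite F d)] with y hy
    rw [hy]; ring
  have hc : Continuous fun y : TwoSite F d => frobSq (reshape y * (reshape y)ᴴ) := by
    simp only [frobSq, Matrix.mul_apply, reshape, Matrix.of_apply, Matrix.conjTranspose_apply]
    fun_prop
  rw [integral_congr_ae h3, integral_add (integrable_const _)
    ((integrable_uniformSphere hc).const_mul _), integral_const_mul,
    integral_frobSq_mul_conjTranspose c hβ hd, quarticValue]
  have : (d : ℝ) * d * β + 2 ≠ 0 := by positivity
  have : (β : ℝ) * d ^ 2 + 2 ≠ 0 := by positivity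
  simp
  field_simp
  ring

theorem HasMean.of_hasLaw {Ω S : Type*} [MeasurableSpace Ω] [MeasurableSpace S] {P : Measure Ω}
    {ν : Measure S} {z : Ω → S} {f : S → ℝ} {m : ℝ} (h : HasMean ν f m)
    (hz : HasLaw z ν P) : HasMean P (fun ω => f (z ω)) m := by
  obtain ⟨h1, h2⟩ := h
  refine ⟨?_, ?_⟩
  · rw [← hz.map_eq] at h1
    exact h1.comp_aemeasurable hz.aemeasurable
  · exact (hz.integral_comp h1.aestronglyMeasurable).trans h2

theorem hasMean_frobSq (c : CompositionBasis F β) (hβ : β ≠ 0) (hd : 1 ≤ d)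
    {Ω : Type*} [MeasurableSpace Ω] {P : Measure Ω} [IsProbabilityMeasure P]
    {x y : Ω → TwoSite F d} (hx : HasLaw x (uniformSphere (TwoSite F d)) P)
    (hy : HasLaw y (uniformSphere (TwoSite F d)) P) (hxy : IndepFun x y P) :
    HasMean P (fun ω => frobSq (reshape (x ω) * reshape (y ω))) (1 / (d : ℝ)) ∧
    HasMean P (fun ω => frobSq ((reshape (x ω) * reshape (y ω)) *
      (reshape (x ω) * reshape (y ω))ᴴ)) (quarticValue β d) := by
  have hd0 : d ≠ 0 := by omega
  have : Nonempty (Fin d) := ⟨⟨0, hd⟩⟩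
  have : Nontrivial F := NormOneClass.nontrivial
  have : Nontrivial (TwoSite F d) := (WithLp.equiv 2 (Fin d × Fin d → F)).nontrivial
  have hlaw := (indepFun_iff_hasLaw_prodMk_prod hx hy).1 hxy
  have h1 : HasMean ((uniformSphere (TwoSite F d)).prod (uniformSphere (TwoSite F d)))
      (fun z => frobSq (reshape z.1 * reshape z.2)) (1 / (d : ℝ)) :=
    And.intro (integrable_uniformSphere_prod (E := TwoSite F d) continuous_frobSq_mul)
      (integral_frobSq_sphere_prod c hβ hd0)
  have h2 : HasMean ((uniformSphere (TwoSite F d)).prod (uniformSphere (TwoSite F d)))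
      (fun z => frobSq ((reshape z.1 * reshape z.2) * (reshape z.1 * reshape z.2)ᴴ))
      (quarticValue β d) :=
    And.intro (integrable_uniformSphere_prod (E := TwoSite F d) continuous_frobSq_mul_conj)
      (integral_frobSq_conj_sphere_prod c hβ hd0)
  have h3 := h1.of_hasLaw hlaw
  have h4 := h2.of_hasLaw hlaw
  exact And.intro h3 h4

end Means

/-! ### The real, complex and quaternionic instances -/

def realCompositionBasis : CompositionBasis ℝ 1 where
  e := OrthonormalBasis.singleton (Fin 1) ℝ
  norm_mul := norm_mul
  mul_star x := by simp [pow_two]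
  -- A common reason for all three algebras: `⟪z, z*⟫ = 2 (Re z)² - |z|²`, and for `z = e_p x e_q*`
  -- the real part is the `q`-th coordinate of `e_p x`. Summing over `p`, `q` gives `2β|x|² -
  -- β²|x|²`, with factors `1`, `0`, `-8`.
  sum_inner_star x := by
    have h : OrthonormalBasis.singleton (Fin 1) ℝ 0 = 1 := OrthonormalBasis.singleton_apply _
    simp only [Fin.sum_univ_one]
    erw [h]
    simp [pow_two]
    norm_num

def complexCompositionBasis : CompositionBasis ℂ 2 where
  e := Complex.orthonormalBasisOneI
  norm_mul := norm_mul
  mul_star x := by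
    simp [Complex.mul_conj, Complex.normSq_eq_norm_sq]
  sum_inner_star x := by
    simp [Fin.sum_univ_two, Complex.inner]
    ring_nf

/-- The quaternion with the given components. -/
def quaternionMk (a b c d : ℝ) : Quaternion ℝ := ⟨a, b, c, d⟩

@[simp] theorem quaternionMk_re (a b c d : ℝ) : (quaternionMk a b c d).re = a := rfl
@[simp] theorem quaternionMk_imI (a b c d : ℝ) : (quaternionMk a b c d).imI = b := rfl
@[simp] theorem quaternionMk_imJ (a b c d : ℝ) : (quaternionMk a b c d).imJ = c := rfl
@[simp] theorem quaternionMk_imK (a b c d : ℝ) : (quaternionMk a b c d).imK = d := rfl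

/-- The basis `1, i, j, k` of the quaternions. -/
def quaternionBasis : OrthonormalBasis (Fin 4) ℝ (Quaternion ℝ) :=
  OrthonormalBasis.mk (v := ![quaternionMk 1 0 0 0, quaternionMk 0 1 0 0, quaternionMk 0 0 1 0,
      quaternionMk 0 0 0 1])
    (by
      rw [orthonormal_iff_ite]
      intro i j
      rw [Quaternion.inner_def]
      fin_cases i <;> fin_cases j <;> simp)
    (by
      intro x _
      rw [Submodule.mem_span_range_iff_exists_fun]
      refine ⟨![x.re, x.imI, x.imJ, x.imK], ?_⟩
      ext <;> simp [Fin.sum_univ_four])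

instance starModule_quaternion : StarModule ℝ (Quaternion ℝ) :=
  ⟨fun r x => by ext <;> simp⟩

open scoped Quaternion in
def quaternionCompositionBasis : CompositionBasis (Quaternion ℝ) 4 where
  e := quaternionBasis
  norm_mul := norm_mul
  mul_star x := by
    rw [Quaternion.self_mul_star, Quaternion.normSq_eq_norm_mul_self]
    ext <;> simp [pow_two]
  sum_inner_star x := by
    rw [pow_two ‖x‖, ← Quaternion.normSq_eq_norm_mul_self, Quaternion.normSq_def']
    simp [Fin.sum_univ_four, quaternionBasis, Quaternion.inner_def]
    ring

/-! ### Möbius changes of variables for the Selberg weight -/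

section Selberg

variable {d : ℕ}

/-- The open positive orthant. -/
def orthant (d : ℕ) : Set (Fin d → ℝ) := {x | ∀ i, 0 < x i}

theorem isOpen_orthant (d : ℕ) : IsOpen (orthant d) := by
  have : orthant d = ⋂ i, {x : Fin d → ℝ | 0 < x i} := by ext; simp [orthant]
  rw [this]
  exact isOpen_iInter_of_finite fun i => isOpen_lt continuous_const (continuous_apply i)

theorem measurableSet_orthant (d : ℕ) : MeasurableSet (orthant d) :=
  (isOpen_orthant d).measurableSet

/-- The algebraic part of the Laguerre weight. -/
def selbergWeight (β : ℝ) (d : ℕ) (x : Fin d → ℝ) : ℝ :=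
  (∏ i, x i ^ (β / 2 - 1)) * ∏ i, ∏ j ∈ Finset.Ioi i, |x i - x j| ^ β

theorem laguerreWeight_eq (β : ℝ) (x : Fin d → ℝ) :
    laguerreWeight β d x = selbergWeight β d x * Real.exp (-(∑ i, x i) / 2) := by
  unfold laguerreWeight selbergWeight
  rw [Finset.prod_mul_distrib, ← Real.exp_sum, ← Finset.sum_div, Finset.sum_neg_distrib]
  ring

theorem selbergWeight_nonneg (β : ℝ) {x : Fin d → ℝ} (hx : x ∈ orthant d) :
    0 ≤ selbergWeight β d x :=
  mul_nonneg (Finset.prod_nonneg fun i _ => Real.rpow_nonneg (hx i).le _)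
    (Finset.prod_nonneg fun _ _ => Finset.prod_nonneg fun _ _ =>
      Real.rpow_nonneg (abs_nonneg _) _)

/-- Each index lies in `d - 1` of the unordered pairs. -/
theorem prod_prod_Ioi_mul (u : Fin d → ℝ) :
    ∏ i, ∏ j ∈ Finset.Ioi i, (u i * u j) = ∏ i, u i ^ (d - 1) := by
  have h := Finset.prod_prod_Ioi_mul_eq_prod_prod_off_diag (fun (_ i : Fin d) => u i)
  simp only [Finset.prod_const, Finset.card_compl, Fintype.card_fin, Finset.card_singleton] at h
  rw [← h]

/-- The diagonal Möbius map. -/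
def mobius (l t : ℝ) (x : Fin d → ℝ) : Fin d → ℝ := fun i => l * x i / (1 + t * x i)

theorem rpow_factor (β l r : ℝ) (hl : 0 < l) (hr : 0 < r) (hd : 1 ≤ d) :
    (l * r) ^ (β / 2 - 1) * ((l ^ (1 / 2 : ℝ) * r) ^ β) ^ (d - 1) * (l * r ^ 2) =
      l ^ (β * d / 2) * r ^ (β / 2 + 1 + β * (d - 1)) := by
  -- Exponential coordinates turn the identity of real powers into a linear one between exponents.
  obtain ⟨a, rfl⟩ : ∃ a, l = Real.exp a := ⟨_, (Real.exp_log hl).symm⟩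
  obtain ⟨b, rfl⟩ : ∃ b, r = Real.exp b := ⟨_, (Real.exp_log hr).symm⟩
  simp only [← Real.exp_mul, ← Real.exp_add, ← Real.exp_nat_mul]
  congr 1
  push_cast [Nat.cast_sub hd]
  ring

/-- A difference of two images is `xᵢ - xⱼ` times `l / ((1 + t xᵢ)(1 + t xⱼ))`. Splitting `l` into
two square roots makes this a product of one-point factors, so the weight and the Jacobian change
only by a product over single coordinates. -/
theorem selbergWeight_mobius (β : ℝ) {l t : ℝ} (hl : 0 < l) (ht : 0 ≤ t) (hd : 1 ≤ d)
    {x : Fin d → ℝ} (hx : x ∈ orthant d) :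
    (∏ i, l / (1 + t * x i) ^ 2) * selbergWeight β d (mobius l t x) =
      selbergWeight β d x *
        ∏ i, (l ^ (β * d / 2) * ((1 + t * x i)⁻¹) ^ (β / 2 + 1 + β * (d - 1))) := by
  have hpos : ∀ i, 0 < 1 + t * x i := fun i => by have := hx i; positivity
  have h1 : ∀ i j, |mobius l t x i - mobius l t x j| ^ β =
      |x i - x j| ^ β * ((l ^ (1 / 2 : ℝ) * (1 + t * x i)⁻¹) ^ β *
        (l ^ (1 / 2 : ℝ) * (1 + t * x j)⁻¹) ^ β) := by
    intro i j
    have hi := hpos i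
    have hj := hpos j
    have hsq : l ^ (1 / 2 : ℝ) * l ^ (1 / 2 : ℝ) = l := by
      rw [← Real.rpow_add hl]; norm_num
    rw [← Real.mul_rpow (by positivity) (by positivity),
      ← Real.mul_rpow (by positivity) (by positivity)]
    congr 1
    have : mobius l t x i - mobius l t x j =
        (x i - x j) * (l * ((1 + t * x i)⁻¹ * (1 + t * x j)⁻¹)) := by
      have hi' := mul_inv_cancel₀ hi.ne'
      have hj' := mul_inv_cancel₀ hj.ne'
      unfold mobius
      linear_combination (-(l * x i * (1 + t * x i)⁻¹)) * hj' + (l * x j * (1 + t * x j)⁻¹) * hi'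
    rw [this, abs_mul, abs_of_nonneg (a := l * _) (by positivity)]
    nth_rewrite 1 [← hsq]
    ring
  have h2 : ∀ i, mobius l t x i ^ (β / 2 - 1) =
      x i ^ (β / 2 - 1) * (l * (1 + t * x i)⁻¹) ^ (β / 2 - 1) := by
    intro i
    have hi := hpos i
    rw [← Real.mul_rpow (hx i).le (by positivity)]
    congr 1
    unfold mobius
    ring
  have hA : ∏ i, mobius l t x i ^ (β / 2 - 1) =
      (∏ i, x i ^ (β / 2 - 1)) * ∏ i, (l * (1 + t * x i)⁻¹) ^ (β / 2 - 1) := by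
    simp only [h2, Finset.prod_mul_distrib]
  have hB : ∏ i, ∏ j ∈ Finset.Ioi i, |mobius l t x i - mobius l t x j| ^ β =
      (∏ i, ∏ j ∈ Finset.Ioi i, |x i - x j| ^ β) *
        ∏ i, ((l ^ (1 / 2 : ℝ) * (1 + t * x i)⁻¹) ^ β) ^ (d - 1) := by
    rw [← prod_prod_Ioi_mul]
    simp only [h1, Finset.prod_mul_distrib]
  have hC : ∏ i, (l ^ (β * d / 2) * ((1 + t * x i)⁻¹) ^ (β / 2 + 1 + β * (d - 1))) =
      (∏ i, (l * (1 + t * x i)⁻¹) ^ (β / 2 - 1)) *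
        (∏ i, ((l ^ (1 / 2 : ℝ) * (1 + t * x i)⁻¹) ^ β) ^ (d - 1)) *
          ∏ i, l / (1 + t * x i) ^ 2 := by
    rw [← Finset.prod_mul_distrib, ← Finset.prod_mul_distrib]
    refine Finset.prod_congr rfl fun i _ => ?_
    rw [← rpow_factor β l _ hl (inv_pos.2 (hpos i)) hd, inv_pow, div_eq_mul_inv l]
  unfold selbergWeight
  rw [hA, hB, hC]
  ring

theorem hasFDerivAt_mobius {l t : ℝ} (ht : 0 ≤ t) {x : Fin d → ℝ} (hx : x ∈ orthant d) :
    HasFDerivAt (mobius l t) (ContinuousLinearMap.pi fun i =>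
      ((l / (1 + t * x i) ^ 2) • ContinuousLinearMap.id ℝ ℝ).comp
        (ContinuousLinearMap.proj (R := ℝ) (φ := fun _ : Fin d => ℝ) i)) x := by
  rw [hasFDerivAt_pi]
  intro i
  have hi : 1 + t * x i ≠ 0 := by have := hx i; positivity
  have h1 : HasDerivAt (fun s : ℝ => l * s / (1 + t * s)) (l / (1 + t * x i) ^ 2) (x i) := by
    have := ((hasDerivAt_id (x i)).const_mul l).div
      (((hasDerivAt_id (x i)).const_mul t).const_add 1) hi
    refine this.congr_deriv ?_
    simp only [id]
    field_simp
    ring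
  have h2 := h1.hasFDerivAt.comp x (ContinuousLinearMap.proj (R := ℝ)
    (φ := fun _ : Fin d => ℝ) i).hasFDerivAt
  refine h2.congr_fderiv ?_
  ext v
  simp [mul_comm]

theorem det_diagonal (a : Fin d → ℝ) : (ContinuousLinearMap.pi fun i =>
      (a i • ContinuousLinearMap.id ℝ ℝ).comp
        (ContinuousLinearMap.proj (R := ℝ) (φ := fun _ : Fin d => ℝ) i)).det = ∏ i, a i := by
  rw [ContinuousLinearMap.det_pi]
  simp [ContinuousLinearMap.det]

theorem injOn_mobius {l t : ℝ} (hl : 0 < l) (ht : 0 ≤ t) :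
    Set.InjOn (mobius l t) (orthant d) := by
  intro x hx y hy h
  ext i
  have h1 : 0 < 1 + t * x i := by have := hx i; positivity
  have h2 : 0 < 1 + t * y i := by have := hy i; positivity
  have h3 := congrFun h i
  simp only [mobius] at h3
  rw [div_eq_div_iff h1.ne' h2.ne'] at h3
  apply mul_left_cancel₀ hl.ne'
  linarith

theorem image_mobius {l t : ℝ} (hl : 0 < l) (ht : 0 ≤ t) :
    mobius l t '' orthant d = {y | ∀ i, 0 < y i ∧ t * y i < l} := by
  ext y
  constructor
  · rintro ⟨x, hx, rfl⟩ i
    have h0 := hx i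
    have h1 : 0 < 1 + t * x i := by positivity
    refine ⟨by unfold mobius; positivity, ?_⟩
    unfold mobius
    rw [← mul_div_assoc, div_lt_iff₀ h1]
    nlinarith
  · intro h
    -- The inverse Möbius map, defined exactly where `t yᵢ < l`.
    refine ⟨fun i => y i / (l - t * y i), fun i => div_pos (h i).1 (sub_pos.2 (h i).2), ?_⟩
    ext i
    have h1 : 0 < l - t * y i := sub_pos.2 (h i).2
    unfold mobius
    have h2 : 1 + t * (y i / (l - t * y i)) = l / (l - t * y i) := by
      field_simp
      ring
    simp only [h2]
    rw [← mul_div_assoc, div_div_div_cancel_right₀ h1.ne', mul_div_cancel_left₀ _ hl.ne']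

/-- Both directions serve: one pulls integrability back along the map, the other pushes it forward
to the image. -/
theorem integrableOn_image_mobius_iff (β : ℝ) {l t : ℝ} (hl : 0 < l) (ht : 0 ≤ t) (hd : 1 ≤ d)
    (g : (Fin d → ℝ) → ℝ) :
    IntegrableOn (fun y => selbergWeight β d y * g y) (mobius l t '' orthant d) ↔
    IntegrableOn (fun x => selbergWeight β d x *
      (∏ i, (l ^ (β * d / 2) * ((1 + t * x i)⁻¹) ^ (β / 2 + 1 + β * (d - 1)))) *
        g (mobius l t x)) (orthant d) := by
  rw [integrableOn_image_iff_integrableOn_abs_det_fderiv_smul volume (measurableSet_orthant d)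
    (fun x hx => (hasFDerivAt_mobius (l := l) ht hx).hasFDerivWithinAt) (injOn_mobius hl ht)]
  refine integrableOn_congr_fun (fun x hx => ?_) (measurableSet_orthant d)
  have hpos : ∀ i, 0 < 1 + t * x i := fun i => by have := hx i; positivity
  rw [det_diagonal, abs_of_nonneg (Finset.prod_nonneg fun i _ => by
    have := hpos i; positivity), ← selbergWeight_mobius β hl ht hd hx, smul_eq_mul]
  ring

theorem setIntegral_image_mobius (β : ℝ) {l t : ℝ} (hl : 0 < l) (ht : 0 ≤ t) (hd : 1 ≤ d)
    (g : (Fin d → ℝ) → ℝ) :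
    ∫ y in mobius l t '' orthant d, selbergWeight β d y * g y =
    ∫ x in orthant d, selbergWeight β d x *
      (∏ i, (l ^ (β * d / 2) * ((1 + t * x i)⁻¹) ^ (β / 2 + 1 + β * (d - 1)))) *
        g (mobius l t x) := by
  rw [integral_image_eq_integral_abs_det_fderiv_smul volume (measurableSet_orthant d)
    (fun x hx => (hasFDerivAt_mobius (l := l) ht hx).hasFDerivWithinAt) (injOn_mobius hl ht)]
  refine setIntegral_congr_fun (measurableSet_orthant d) (fun x hx => ?_)
  have hpos : ∀ i, 0 < 1 + t * x i := fun i => by have := hx i; positivity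
  rw [det_diagonal, abs_of_nonneg (Finset.prod_nonneg fun i _ => by
    have := hpos i; positivity), ← selbergWeight_mobius β hl ht hd hx, smul_eq_mul]
  ring

end Selberg

/-! ### Integrability and positivity of the Laguerre weight -/

section Integrability

variable {d : ℕ}

theorem measurable_laguerreWeight (β : ℝ) (d : ℕ) : Measurable (laguerreWeight β d) := by
  unfold laguerreWeight
  fun_prop

theorem laguerreWeight_nonneg (β : ℝ) {x : Fin d → ℝ} (hx : x ∈ orthant d) :
    0 ≤ laguerreWeight β d x := by
  rw [laguerreWeight_eq]
  exact mul_nonneg (selbergWeight_nonneg β hx) (Real.exp_pos _).le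

theorem le_sum_of_mem_orthant {x : Fin d → ℝ} (hx : x ∈ orthant d) (i : Fin d) :
    x i ≤ ∑ j, x j :=
  Finset.single_le_sum (fun j _ => (hx j).le) (Finset.mem_univ i)

theorem sum_nonneg_of_mem_orthant {x : Fin d → ℝ} (hx : x ∈ orthant d) : 0 ≤ ∑ j, x j :=
  Finset.sum_nonneg fun j _ => (hx j).le

theorem exists_pow_le_exp (m : ℕ) : ∃ C : ℝ, 0 ≤ C ∧ ∀ s : ℝ, 0 ≤ s →
    (1 + s) ^ m ≤ C * Real.exp (s / 4) := by
  refine ⟨4 ^ m * m.factorial * Real.exp (1 / 4), by positivity, fun s hs => ?_⟩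
  have h := Real.pow_div_factorial_le_exp ((1 + s) / 4) (by positivity) m
  rw [div_le_iff₀ (by positivity), div_pow, div_le_iff₀ (by positivity)] at h
  calc (1 + s) ^ m ≤ _ := h
    _ = _ := by rw [add_div, Real.exp_add]; ring

/-- Half of the decay `exp(-s/2)` absorbs the Vandermonde factor and the power of `s`, both
polynomially bounded in `1 + s`. The other half leaves a product of one-variable Gamma densities. -/
theorem exists_laguerreWeight_mul_pow_le {β : ℝ} (hβ : 0 < β) (d k : ℕ) :
    ∃ C : ℝ, ∀ x ∈ orthant d, laguerreWeight β d x * (∑ i, x i) ^ k ≤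
      C * ∏ i, (x i ^ (β / 2 - 1) * Real.exp (-(1 / 4) * x i ^ (1 : ℝ))) := by
  set M := ∑ i : Fin d, (Finset.Ioi i).card with hM
  obtain ⟨m, hm⟩ := exists_nat_ge (β * M)
  obtain ⟨C, hC0, hC⟩ := exists_pow_le_exp (k + m)
  refine ⟨C, fun x hx => ?_⟩
  have hs := sum_nonneg_of_mem_orthant hx
  set s := ∑ i, x i with hsdef
  have h1 : ∏ i, ∏ j ∈ Finset.Ioi i, |x i - x j| ^ β ≤ (1 + s) ^ m := by
    calc ∏ i, ∏ j ∈ Finset.Ioi i, |x i - x j| ^ β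
        ≤ ∏ i : Fin d, ∏ j ∈ Finset.Ioi i, (1 + s) ^ β := by
          refine Finset.prod_le_prod (fun i _ => Finset.prod_nonneg fun j _ => by positivity)
            fun i _ => Finset.prod_le_prod (fun j _ => by positivity) fun j _ => ?_
          refine Real.rpow_le_rpow (abs_nonneg _) ?_ hβ.le
          have hi := le_sum_of_mem_orthant hx i
          have hj := le_sum_of_mem_orthant hx j
          have := hx i
          have := hx j
          rw [abs_le]
          constructor <;> linarith
      _ = ((1 + s) ^ β) ^ M := by
          simp only [Finset.prod_const, hM, Finset.prod_pow_eq_pow_sum]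
      _ = (1 + s) ^ (β * M) := by
          rw [Real.rpow_mul (by positivity), Real.rpow_natCast]
      _ ≤ (1 + s) ^ (m : ℝ) := Real.rpow_le_rpow_of_exponent_le (by linarith) hm
      _ = (1 + s) ^ m := Real.rpow_natCast _ _
  have h2 : s ^ k ≤ (1 + s) ^ k := pow_le_pow_left₀ hs (by linarith) k
  have hP : 0 ≤ ∏ i, x i ^ (β / 2 - 1) :=
    Finset.prod_nonneg fun i _ => Real.rpow_nonneg (hx i).le _
  rw [laguerreWeight_eq, selbergWeight]
  have h3 : Real.exp (s / 4) * Real.exp (-s / 2) = ∏ i, Real.exp (-(1 / 4) * x i ^ (1 : ℝ)) := by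
    rw [← Real.exp_add, ← Real.exp_sum, ← Finset.mul_sum]
    simp only [Real.rpow_one, ← hsdef]
    congr 1
    ring
  rw [Finset.prod_mul_distrib, ← h3]
  calc (∏ i, x i ^ (β / 2 - 1)) * (∏ i, ∏ j ∈ Finset.Ioi i, |x i - x j| ^ β) *
        Real.exp (-s / 2) * s ^ k
      = (∏ i, x i ^ (β / 2 - 1)) * Real.exp (-s / 2) *
        (s ^ k * ∏ i, ∏ j ∈ Finset.Ioi i, |x i - x j| ^ β) := by ring
    _ ≤ (∏ i, x i ^ (β / 2 - 1)) * Real.exp (-s / 2) * ((1 + s) ^ k * (1 + s) ^ m) := by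
        gcongr
    _ ≤ (∏ i, x i ^ (β / 2 - 1)) * Real.exp (-s / 2) * (C * Real.exp (s / 4)) := by
        rw [← pow_add]
        exact mul_le_mul_of_nonneg_left (hC s hs) (mul_nonneg hP (Real.exp_pos _).le)
    _ = _ := by ring

theorem integrableOn_prod_rpow_mul_exp {β : ℝ} (hβ : 0 < β) (d : ℕ) :
    IntegrableOn (fun x : Fin d → ℝ => ∏ i, (x i ^ (β / 2 - 1) *
      Real.exp (-(1 / 4) * x i ^ (1 : ℝ)))) (orthant d) := by
  have h : orthant d = Set.univ.pi fun _ => Set.Ioi 0 := by ext; simp [orthant]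
  rw [IntegrableOn, h, volume_pi, Measure.restrict_pi_pi]
  exact Integrable.fintype_prod fun _ =>
    integrableOn_rpow_mul_exp_neg_mul_rpow (by linarith) one_pos (by norm_num)

/-- Functions of polynomial growth are integrable for the Laguerre weight. -/
theorem integrableOn_laguerreWeight_mul {β : ℝ} (hβ : 0 < β) {f : (Fin d → ℝ) → ℝ}
    (hf : Measurable f) {K : ℝ} (k : ℕ)
    (hK : ∀ x ∈ orthant d, |f x| ≤ K * (∑ i, x i) ^ k) :
    IntegrableOn (fun x => laguerreWeight β d x * f x) (orthant d) := by
  obtain ⟨C, hC⟩ := exists_laguerreWeight_mul_pow_le hβ d k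
  refine ((integrableOn_prod_rpow_mul_exp hβ d).const_mul (|K| * C)).mono'
    ((measurable_laguerreWeight β d).mul hf).aestronglyMeasurable ?_
  filter_upwards [ae_restrict_mem (measurableSet_orthant d)] with x hx
  have hw := laguerreWeight_nonneg β hx
  have hs := sum_nonneg_of_mem_orthant hx
  rw [norm_mul, Real.norm_of_nonneg hw, Real.norm_eq_abs]
  calc laguerreWeight β d x * |f x| ≤ laguerreWeight β d x * (|K| * (∑ i, x i) ^ k) := by
        gcongr
        exact (hK x hx).trans (by gcongr; exact le_abs_self K)
    _ = |K| * (laguerreWeight β d x * (∑ i, x i) ^ k) := by ring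
    _ ≤ |K| * (C * ∏ i, (x i ^ (β / 2 - 1) * Real.exp (-(1 / 4) * x i ^ (1 : ℝ)))) := by
        exact mul_le_mul_of_nonneg_left (hC x hx) (abs_nonneg K)
    _ = _ := by ring

theorem sum_pow_le_pow_sum {x : Fin d → ℝ} (hx : x ∈ orthant d) (k : ℕ) :
    ∑ i, x i ^ (k + 1) ≤ (∑ i, x i) ^ (k + 1) := by
  rw [pow_succ _ k, Finset.mul_sum]
  refine Finset.sum_le_sum fun i _ => ?_
  rw [pow_succ]
  have := (hx i).le
  gcongr
  exact le_sum_of_mem_orthant hx i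

theorem integrableOn_laguerreWeight_mul_powerSum {β : ℝ} (hβ : 0 < β) (d k : ℕ) :
    IntegrableOn (fun x => laguerreWeight β d x * ∑ i, x i ^ (k + 1)) (orthant d) := by
  refine integrableOn_laguerreWeight_mul hβ (by fun_prop) (K := 1) (k + 1) fun x hx => ?_
  rw [abs_of_nonneg (Finset.sum_nonneg fun i _ => pow_nonneg (hx i).le _), one_mul]
  exact sum_pow_le_pow_sum hx k

theorem integrableOn_laguerreWeight_mul_sum_pow {β : ℝ} (hβ : 0 < β) (d k : ℕ) :
    IntegrableOn (fun x => laguerreWeight β d x * (∑ i, x i) ^ k) (orthant d) := by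
  refine integrableOn_laguerreWeight_mul hβ (by fun_prop) (K := 1) k fun x hx => ?_
  rw [abs_of_nonneg (pow_nonneg (sum_nonneg_of_mem_orthant hx) _), one_mul]

theorem integrableOn_laguerreWeight {β : ℝ} (hβ : 0 < β) (d : ℕ) :
    IntegrableOn (laguerreWeight β d) (orthant d) := by
  simpa using integrableOn_laguerreWeight_mul_sum_pow hβ d 0

theorem setIntegral_laguerreWeight_pos {β : ℝ} (hβ : 0 < β) (d : ℕ) :
    0 < ∫ x in orthant d, laguerreWeight β d x := by
  -- On the open chamber of increasing positive coordinates no factor of the weight vanishes.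
  set U : Set (Fin d → ℝ) := orthant d ∩ {x | ∀ i j, i < j → x i < x j} with hU
  have hUo : IsOpen U := by
    have : {x : Fin d → ℝ | ∀ i j, i < j → x i < x j} =
        ⋂ i, ⋂ j, ⋂ (_ : i < j), {x : Fin d → ℝ | x i < x j} := by ext; simp
    refine (isOpen_orthant d).inter ?_
    rw [this]
    exact isOpen_iInter_of_finite fun i => isOpen_iInter_of_finite fun j =>
      isOpen_iInter_of_finite fun _ => isOpen_lt (continuous_apply i) (continuous_apply j)
  have hUn : U.Nonempty := by
    refine ⟨fun i => (i : ℕ) + 1, fun i => by positivity, fun i j hij => ?_⟩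
    have : (i : ℕ) < j := hij
    simpa using this
  rw [setIntegral_pos_iff_support_of_nonneg_ae
    (by filter_upwards [ae_restrict_mem (measurableSet_orthant d)] with x hx
        exact laguerreWeight_nonneg β hx) (integrableOn_laguerreWeight hβ d)]
  refine (hUo.measure_pos volume hUn).trans_le (measure_mono fun x hx => ⟨?_, hx.1⟩)
  rw [Function.mem_support, laguerreWeight_eq, selbergWeight]
  refine mul_ne_zero (mul_ne_zero ?_ ?_) (Real.exp_pos _).ne'
  · exact Finset.prod_ne_zero_iff.2 fun i _ => (Real.rpow_pos_of_pos (hx.1 i) _).ne'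
  · refine Finset.prod_ne_zero_iff.2 fun i _ => Finset.prod_ne_zero_iff.2 fun j hj => ?_
    have := hx.2 i j (Finset.mem_Ioi.1 hj)
    exact (Real.rpow_pos_of_pos (abs_pos.2 (by linarith)) _).ne'

end Integrability

/-! ### Moment identities from the scaling and Möbius flows -/

section Moments

variable {d : ℕ}

/-- Radial integration by parts for homogeneous functions. -/
theorem setIntegral_laguerreWeight_mul_sum {β : ℝ} (hd : 1 ≤ d) {h : (Fin d → ℝ) → ℝ}
    (k : ℕ) (hk : ∀ l : ℝ, 0 < l → ∀ x ∈ orthant d, h (l • x) = l ^ k * h x)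
    (hpos : ∀ x ∈ orthant d, 0 ≤ h x)
    (hi : IntegrableOn (fun x => laguerreWeight β d x * h x) (orthant d))
    (hi' : IntegrableOn (fun x => laguerreWeight β d x * (h x * ∑ i, x i)) (orthant d)) :
    ∫ x in orthant d, laguerreWeight β d x * (h x * ∑ i, x i) =
      (β * d ^ 2 + 2 * k) * ∫ x in orthant d, laguerreWeight β d x * h x := by
  set A := ∫ x in orthant d, laguerreWeight β d x * h x with hA
  set B := ∫ x in orthant d, laguerreWeight β d x * (h x * ∑ i, x i) with hB
  -- Scaling by `l` is the Möbius map with `t = 0`. The bound `exp y ≥ 1 + y` turns the exact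
  -- identity into an inequality with equality at `l = 1`, so the derivative there vanishes.
  have key : ∀ l : ℝ, 0 < l →
      0 ≤ A - l ^ (β * d ^ 2 / 2 + k : ℝ) * (A - (l - 1) / 2 * B) := by
    intro l hl
    have him : mobius l 0 '' orthant d = orthant d := by
      rw [image_mobius hl le_rfl]; ext y; simp [orthant, hl]
    have hw : ∀ y : Fin d → ℝ, selbergWeight β d y * (Real.exp (-(∑ i, y i) / 2) * h y) =
        laguerreWeight β d y * h y := fun y => by rw [laguerreWeight_eq, mul_assoc]
    have hmob : ∀ x : Fin d → ℝ, mobius l 0 x = l • x := by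
      intro x; ext i; simp [mobius]
    have hprod : ∏ _i : Fin d, l ^ (β * d / 2) = l ^ (β * d ^ 2 / 2) := by
      rw [Finset.prod_const, Finset.card_univ, Fintype.card_fin, ← Real.rpow_natCast,
        ← Real.rpow_mul hl.le]
      congr 1; ring
    have hc : Set.EqOn (fun x => selbergWeight β d x *
        (∏ i, (l ^ (β * d / 2) * ((1 + 0 * x i)⁻¹) ^ (β / 2 + 1 + β * (d - 1)))) *
        (Real.exp (-(∑ i, mobius l 0 x i) / 2) * h (mobius l 0 x)))
        (fun x => l ^ (β * d ^ 2 / 2 + k : ℝ) *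
          (laguerreWeight β d x * h x * Real.exp (-((l - 1) / 2 * ∑ i, x i)))) (orthant d) := by
      intro x hx
      simp only [zero_mul, add_zero, inv_one, Real.one_rpow, mul_one, hprod, hmob, hk l hl x hx,
        laguerreWeight_eq, Real.rpow_add hl, Real.rpow_natCast, Pi.smul_apply, smul_eq_mul,
        ← Finset.mul_sum]
      have : Real.exp (-(l * ∑ i, x i) / 2) = Real.exp (-(∑ i, x i) / 2) *
          Real.exp (-((l - 1) / 2 * ∑ i, x i)) := by
        rw [← Real.exp_add]; congr 1; ring
      rw [this]
      ring
    have h1 := setIntegral_image_mobius β hl le_rfl hd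
      (fun y => Real.exp (-(∑ i, y i) / 2) * h y)
    have h2 := integrableOn_image_mobius_iff β hl le_rfl hd
      (fun y => Real.exp (-(∑ i, y i) / 2) * h y)
    rw [him, setIntegral_congr_fun (measurableSet_orthant d) hc, integral_const_mul] at h1
    rw [him, integrableOn_congr_fun hc (measurableSet_orthant d)] at h2
    simp only [hw] at h1 h2
    have hp : 0 < l ^ (β * d ^ 2 / 2 + k : ℝ) := Real.rpow_pos_of_pos hl _
    have h3 : IntegrableOn (fun x => laguerreWeight β d x * h x *
        Real.exp (-((l - 1) / 2 * ∑ i, x i))) (orthant d) := by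
      have := (h2.1 hi).const_mul (l ^ (β * d ^ 2 / 2 + k : ℝ))⁻¹
      simpa [hp.ne', IntegrableOn] using this
    have h4 : A - (l - 1) / 2 * B ≤ ∫ x in orthant d, laguerreWeight β d x * h x *
        Real.exp (-((l - 1) / 2 * ∑ i, x i)) := by
      rw [hA, hB, ← integral_const_mul, ← integral_sub hi (hi'.const_mul _)]
      refine setIntegral_mono_on (hi.sub (hi'.const_mul _)) h3 (measurableSet_orthant d)
        fun x hx => ?_
      have := Real.add_one_le_exp (-((l - 1) / 2 * ∑ i, x i))
      have h0 := mul_nonneg (laguerreWeight_nonneg β hx) (hpos x hx)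
      nlinarith [mul_le_mul_of_nonneg_left this h0]
    have := mul_le_mul_of_nonneg_left h4 hp.le
    linarith
  set p : ℝ := β * d ^ 2 / 2 + k with hp
  have hmin : IsLocalMin (fun l : ℝ => A - l ^ p * (A - (l - 1) / 2 * B)) 1 := by
    filter_upwards [lt_mem_nhds (one_pos : (0 : ℝ) < 1)] with l hl
    simpa using key l hl
  have hder : HasDerivAt (fun l : ℝ => A - l ^ p * (A - (l - 1) / 2 * B))
      (-(p * A - B / 2)) 1 := by
    have h1 := Real.hasDerivAt_rpow_const (x := 1) (p := p) (Or.inl one_ne_zero)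
    have h2 : HasDerivAt (fun l : ℝ => A - (l - 1) / 2 * B) (-(1 / 2 * B)) 1 :=
      (((((hasDerivAt_id (1 : ℝ)).sub_const 1).div_const 2).mul_const B).const_sub A)
    refine ((h1.mul h2).const_sub A).congr_deriv ?_
    simp
    ring
  have := hmin.hasDerivAt_eq_zero hder
  rw [hp] at this
  linarith

/-- The limit `t → 0⁺`, which extracts the first-order term of the Möbius inequalities. -/
theorem nonpos_of_forall_le_mul {X K : ℝ} (h : ∀ t : ℝ, 0 < t → t ≤ 1 → X ≤ t * K) : X ≤ 0 := by
  by_contra! hX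
  have hK : 0 < |K| + 1 := by positivity
  have h1 := h (min 1 (X / (2 * (|K| + 1)))) (by positivity) (min_le_left _ _)
  have h2 : min 1 (X / (2 * (|K| + 1))) * K ≤ X / (2 * (|K| + 1)) * (|K| + 1) := by
    refine (mul_le_mul_of_nonneg_left (by linarith [le_abs_self K]) (by positivity)).trans
      (mul_le_mul_of_nonneg_right (min_le_right _ _) hK.le)
  have h3 : X / (2 * (|K| + 1)) * (|K| + 1) = X / 2 := by field_simp
  linarith

/-- The exponent in the Jacobian of the Möbius map. -/
def mobiusExponent (β : ℝ) (d : ℕ) : ℝ := β / 2 + 1 + β * (d - 1)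

theorem mobiusExponent_pos {β : ℝ} (hβ : 0 < β) (hd : 1 ≤ d) : 0 < mobiusExponent β d := by
  have : (1 : ℝ) ≤ d := by exact_mod_cast hd
  unfold mobiusExponent
  have := mul_nonneg hβ.le (sub_nonneg.2 this)
  positivity

theorem image_mobius_subset {t : ℝ} (ht : 0 ≤ t) : mobius 1 t '' orthant d ⊆ orthant d := by
  rw [image_mobius one_pos ht]
  exact fun y hy i => (hy i).1

theorem measurableSet_image_mobius {t : ℝ} (ht : 0 ≤ t) :
    MeasurableSet (mobius 1 t '' orthant d) := by
  rw [image_mobius one_pos ht]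
  have : {y : Fin d → ℝ | ∀ i, 0 < y i ∧ t * y i < 1} =
      ⋂ i, {y : Fin d → ℝ | 0 < y i ∧ t * y i < 1} := by ext; simp
  rw [this]
  refine MeasurableSet.iInter fun i => ?_
  have h1 : MeasurableSet {y : Fin d → ℝ | 0 < y i} :=
    measurableSet_lt measurable_const (measurable_pi_apply i)
  have h2 : MeasurableSet {y : Fin d → ℝ | t * y i < 1} :=
    measurableSet_lt (by fun_prop) measurable_const
  exact h1.inter h2

theorem integral_add_three {α : Type*} [MeasurableSpace α] {μ : Measure α} {f f₁ f₂ f₃ : α → ℝ}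
    (h : Integrable f μ) (h₁ : Integrable f₁ μ) (h₂ : Integrable f₂ μ) (h₃ : Integrable f₃ μ)
    (a b c : ℝ) :
    Integrable (fun x => f x + a * f₁ x + b * f₂ x + c * f₃ x) μ ∧
    ∫ x, f x + a * f₁ x + b * f₂ x + c * f₃ x ∂μ =
      ∫ x, f x ∂μ + a * ∫ x, f₁ x ∂μ + b * ∫ x, f₂ x ∂μ + c * ∫ x, f₃ x ∂μ := by
  have h1 : Integrable (fun x => f x + a * f₁ x) μ := h.add (h₁.const_mul a)
  have h2 : Integrable (fun x => f x + a * f₁ x + b * f₂ x) μ := h1.add (h₂.const_mul b)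
  refine ⟨h2.add (h₃.const_mul c), ?_⟩
  rw [integral_add h2 (h₃.const_mul c), integral_add h1 (h₂.const_mul b),
    integral_add h (h₁.const_mul a)]
  simp only [integral_const_mul]

theorem exp_neg_mul_le_rpow {c r : ℝ} (hc : 0 ≤ c) (hr : 0 ≤ r) :
    Real.exp (-(c * r)) ≤ ((1 + r)⁻¹) ^ c := by
  have h : Real.exp (-r) ≤ (1 + r)⁻¹ := by
    rw [Real.exp_neg]
    refine inv_anti₀ (by positivity) ?_
    linarith [Real.add_one_le_exp r]
  calc Real.exp (-(c * r)) = Real.exp (-r) ^ c := by rw [← Real.exp_mul]; congr 1; ring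
    _ ≤ _ := Real.rpow_le_rpow (Real.exp_pos _).le h hc

theorem exp_mul_le_rpow {c r : ℝ} (hc : 0 ≤ c) (hr : r < 1) :
    Real.exp (c * r) ≤ ((1 - r)⁻¹) ^ c := by
  have h : Real.exp r ≤ (1 - r)⁻¹ := by
    rw [← neg_neg r, Real.exp_neg, neg_neg]
    refine inv_anti₀ (by linarith) ?_
    linarith [Real.add_one_le_exp (-r)]
  calc Real.exp (c * r) = Real.exp r ^ c := by rw [← Real.exp_mul]; congr 1; ring
    _ ≤ _ := Real.rpow_le_rpow (Real.exp_pos _).le h hc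

/-- The map `x/(1 + t x)` sends the orthant into itself, so the weight of the image is at most the
total. Bounding the pulled-back weight below to first order in `t` leaves `t(⟨p₂⟩/2 - c⟨p₁⟩) ≤
t²⟨p₃⟩/2`. -/
theorem half_secondMoment_le {β : ℝ} (hβ : 0 < β) (hd : 1 ≤ d) :
    (∫ x in orthant d, laguerreWeight β d x * ∑ i, x i ^ 2) / 2 ≤
      mobiusExponent β d * ∫ x in orthant d, laguerreWeight β d x * ∑ i, x i ^ 1 := by
  set c := mobiusExponent β d with hc
  have hc0 : 0 < c := mobiusExponent_pos hβ hd
  have i0 := integrableOn_laguerreWeight hβ d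
  have i1 := integrableOn_laguerreWeight_mul_powerSum hβ d 0
  have i2 := integrableOn_laguerreWeight_mul_powerSum hβ d 1
  have i3 := integrableOn_laguerreWeight_mul_powerSum hβ d 2
  simp only [zero_add, Nat.reduceAdd] at i1 i2 i3
  refine sub_nonpos.1 (nonpos_of_forall_le_mul
    (K := (∫ x in orthant d, laguerreWeight β d x * ∑ i, x i ^ 3) / 2) fun t ht _ => ?_)
  have h1 := setIntegral_image_mobius β one_pos ht.le hd (fun y => Real.exp (-(∑ i, y i) / 2))
  have h2 := integrableOn_image_mobius_iff β one_pos ht.le hd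
    (fun y => Real.exp (-(∑ i, y i) / 2))
  simp only [← laguerreWeight_eq, Real.one_rpow, one_mul] at h1 h2
  have h3 := h2.1 (i0.mono_set (image_mobius_subset ht.le))
  have h4 : ∫ y in mobius 1 t '' orthant d, laguerreWeight β d y ≤
      ∫ y in orthant d, laguerreWeight β d y :=
    setIntegral_mono_set i0 (by
      filter_upwards [ae_restrict_mem (measurableSet_orthant d)] with x hx
      exact laguerreWeight_nonneg β hx) (image_mobius_subset ht.le).eventuallyLE
  obtain ⟨h5, h6⟩ := integral_add_three i0 i1 i2 i3 (-(t * c)) (t / 2) (-(t ^ 2 / 2))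
  have h7 := setIntegral_mono_on h5 h3 (measurableSet_orthant d) fun x hx => by
    have hD := selbergWeight_nonneg β hx
    have hA : Real.exp (∑ i, -(c * (t * x i))) ≤
        ∏ i, ((1 + t * x i)⁻¹) ^ (β / 2 + 1 + β * (d - 1)) := by
      rw [Real.exp_sum]
      refine Finset.prod_le_prod (fun i _ => (Real.exp_pos _).le) fun i _ => ?_
      exact exp_neg_mul_le_rpow hc0.le (mul_nonneg ht.le (hx i).le)
    -- From `1/(1 + r) ≤ 1 - r + r²` for `r ≥ 0`.
    have hB : ∑ i, mobius 1 t x i ≤ ∑ i, (x i - t * x i ^ 2 + t ^ 2 * x i ^ 3) := by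
      refine Finset.sum_le_sum fun i _ => ?_
      have hi := hx i
      unfold mobius
      rw [div_le_iff₀ (by positivity)]
      have : 0 ≤ t ^ 3 * x i ^ 4 := by positivity
      nlinarith
    have hz : Real.exp (∑ i, -(c * (t * x i))) *
        Real.exp (-(∑ i, (x i - t * x i ^ 2 + t ^ 2 * x i ^ 3)) / 2) =
        Real.exp (-(∑ i, x i) / 2) * Real.exp (-(t * c) * ∑ i, x i ^ 1 +
          t / 2 * ∑ i, x i ^ 2 + -(t ^ 2 / 2) * ∑ i, x i ^ 3) := by
      rw [← Real.exp_add, ← Real.exp_add]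
      congr 1
      simp only [Finset.sum_add_distrib, Finset.sum_sub_distrib, ← Finset.mul_sum,
        Finset.sum_neg_distrib, pow_one]
      ring
    have he := Real.add_one_le_exp (-(t * c) * ∑ i, x i ^ 1 +
      t / 2 * ∑ i, x i ^ 2 + -(t ^ 2 / 2) * ∑ i, x i ^ 3)
    calc _ = selbergWeight β d x * (Real.exp (-(∑ i, x i) / 2) *
          (-(t * c) * ∑ i, x i ^ 1 + t / 2 * ∑ i, x i ^ 2 + -(t ^ 2 / 2) * ∑ i, x i ^ 3 + 1)) := by
          rw [laguerreWeight_eq]; ring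
      _ ≤ selbergWeight β d x * (Real.exp (-(∑ i, x i) / 2) *
          Real.exp (-(t * c) * ∑ i, x i ^ 1 +
            t / 2 * ∑ i, x i ^ 2 + -(t ^ 2 / 2) * ∑ i, x i ^ 3)) := by gcongr
      _ = selbergWeight β d x * (Real.exp (∑ i, -(c * (t * x i))) *
        Real.exp (-(∑ i, (x i - t * x i ^ 2 + t ^ 2 * x i ^ 3)) / 2)) := by rw [hz]
      _ ≤ selbergWeight β d x * ((∏ i, ((1 + t * x i)⁻¹) ^ (β / 2 + 1 + β * (d - 1))) *
          Real.exp (-(∑ i, mobius 1 t x i) / 2)) := by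
          refine mul_le_mul_of_nonneg_left (mul_le_mul hA (Real.exp_le_exp.2 (by linarith))
            (Real.exp_pos _).le ((Real.exp_pos _).le.trans hA)) hD
      _ = _ := by ring
  rw [h6, ← h1] at h7
  have h8 := h7.trans h4
  refine le_of_mul_le_mul_left ?_ ht
  linarith

/-- The opposite inequality comes from the inverse flow `y/(1 - t y)`, which lives only on the
image. There the transported weight has integral exactly `⟨1⟩`; extended by zero, it is bounded
below to first order on the whole orthant. -/
theorem le_half_secondMoment {β : ℝ} (hβ : 0 < β) (hd : 1 ≤ d) :
    mobiusExponent β d * (∫ x in orthant d, laguerreWeight β d x * ∑ i, x i ^ 1) ≤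
      (∫ x in orthant d, laguerreWeight β d x * ∑ i, x i ^ 2) / 2 := by
  set c := mobiusExponent β d with hc
  have hc0 : 0 < c := mobiusExponent_pos hβ hd
  have i0 := integrableOn_laguerreWeight hβ d
  have i1 := integrableOn_laguerreWeight_mul_powerSum hβ d 0
  have i2 := integrableOn_laguerreWeight_mul_powerSum hβ d 1
  have i3 := integrableOn_laguerreWeight_mul_powerSum hβ d 2
  have i4 := (integrableOn_laguerreWeight_mul_sum_pow hβ d 2).const_mul 4
  have i5 := (integrableOn_laguerreWeight_mul_sum_pow hβ d 3).const_mul (4 * c)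
  simp only [zero_add, Nat.reduceAdd] at i1 i2 i3
  have i6 := (i3.add i4).add i5
  refine sub_nonpos.1 (nonpos_of_forall_le_mul
    (K := ∫ x in orthant d, (laguerreWeight β d x * ∑ i, x i ^ 3 +
      4 * (laguerreWeight β d x * (∑ i, x i) ^ 2)) +
      4 * c * (laguerreWeight β d x * (∑ i, x i) ^ 3)) fun t ht ht1 => ?_)
  -- Chosen so that the change of variables cancels the Jacobian factors and restores the Laguerre
  -- weight.
  set g : (Fin d → ℝ) → ℝ := fun y => Real.exp (-(∑ i, y i / (1 - t * y i)) / 2) *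
    ∏ i, ((1 - t * y i)⁻¹) ^ c with hg
  have hgx : Set.EqOn (fun x => selbergWeight β d x *
      (∏ i, ((1 : ℝ) ^ (β * d / 2) * ((1 + t * x i)⁻¹) ^ (β / 2 + 1 + β * (d - 1)))) *
        g (mobius 1 t x)) (laguerreWeight β d) (orthant d) := by
    intro x hx
    have hpos : ∀ i, 0 < 1 + t * x i := fun i => by have := hx i; positivity
    have e1 : ∀ i, 1 - t * mobius 1 t x i = (1 + t * x i)⁻¹ := by
      intro i
      have := mul_inv_cancel₀ (hpos i).ne'
      unfold mobius
      linear_combination -this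
    have e2 : ∀ i, mobius 1 t x i / (1 + t * x i)⁻¹ = x i := by
      intro i
      unfold mobius
      rw [one_mul, div_inv_eq_mul, div_mul_cancel₀ _ (hpos i).ne']
    have e3 : (∏ i, ((1 + t * x i)⁻¹) ^ c) * ∏ i, (1 + t * x i) ^ c = 1 := by
      rw [← Finset.prod_mul_distrib]
      refine Finset.prod_eq_one fun i _ => ?_
      rw [← Real.mul_rpow (inv_nonneg.2 (hpos i).le) (hpos i).le,
        inv_mul_cancel₀ (hpos i).ne', Real.one_rpow]
    simp only [hg, e1, e2, inv_inv, Real.one_rpow, one_mul, laguerreWeight_eq]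
    change selbergWeight β d x * (∏ i, ((1 + t * x i)⁻¹) ^ c) * _ = _
    linear_combination (selbergWeight β d x * Real.exp (-(∑ i, x i) / 2)) * e3
  have h1 := setIntegral_image_mobius β one_pos ht.le hd g
  have h2 := integrableOn_image_mobius_iff β one_pos ht.le hd g
  rw [setIntegral_congr_fun (measurableSet_orthant d) hgx] at h1
  rw [integrableOn_congr_fun hgx (measurableSet_orthant d)] at h2
  have h3 := h2.2 i0
  obtain ⟨h5, h6⟩ := integral_add_three i0 i1 i2 i6 (t * c) (-(t / 2)) (-(t ^ 2))
  have hmeas := measurableSet_image_mobius (d := d) ht.le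
  have h4 : IntegrableOn ((mobius 1 t '' orthant d).indicator
      fun y => selbergWeight β d y * g y) (orthant d) :=
    ((integrable_indicator_iff hmeas).2 h3).integrableOn
  have h7 := setIntegral_mono_on h5 h4 (measurableSet_orthant d) fun x hx => by
    have hD := selbergWeight_nonneg β hx
    have hw := laguerreWeight_nonneg β hx
    have hs := sum_nonneg_of_mem_orthant hx
    have hp2 : 0 ≤ ∑ i, x i ^ 2 := Finset.sum_nonneg fun i _ => by positivity
    have hp3 : 0 ≤ ∑ i, x i ^ 3 := Finset.sum_nonneg fun i _ => pow_nonneg (hx i).le _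
    have hs2 := pow_nonneg hs 2
    have hs3 := pow_nonneg hs 3
    by_cases hsmall : ∀ i, t * x i ≤ 1 / 2
    · have hmem : x ∈ mobius 1 t '' orthant d := by
        rw [image_mobius one_pos ht.le]
        exact fun i => ⟨hx i, by linarith [hsmall i]⟩
      rw [Set.indicator_of_mem hmem]
      have hA : Real.exp (∑ i, c * (t * x i)) ≤ ∏ i, ((1 - t * x i)⁻¹) ^ c := by
        rw [Real.exp_sum]
        refine Finset.prod_le_prod (fun i _ => (Real.exp_pos _).le) fun i _ => ?_
        exact exp_mul_le_rpow hc0.le (by linarith [hsmall i])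
      -- From `1/(1 - r) ≤ 1 + r + 2r²` for `0 ≤ r ≤ 1/2`.
      have hB : ∑ i, x i / (1 - t * x i) ≤
          ∑ i, (x i + t * x i ^ 2 + 2 * t ^ 2 * x i ^ 3) := by
        refine Finset.sum_le_sum fun i _ => ?_
        have hi := hx i
        have hi' := hsmall i
        rw [div_le_iff₀ (by linarith)]
        have : 0 ≤ t ^ 2 * x i ^ 3 * (1 - 2 * (t * x i)) :=
          mul_nonneg (by positivity) (by linarith)
        nlinarith
      have hz : Real.exp (-(∑ i, (x i + t * x i ^ 2 + 2 * t ^ 2 * x i ^ 3)) / 2) *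
          Real.exp (∑ i, c * (t * x i)) = Real.exp (-(∑ i, x i) / 2) *
          Real.exp (t * c * ∑ i, x i ^ 1 + -(t / 2) * ∑ i, x i ^ 2 + -(t ^ 2) * ∑ i, x i ^ 3) := by
        rw [← Real.exp_add, ← Real.exp_add]
        congr 1
        simp only [Finset.sum_add_distrib, ← Finset.mul_sum, pow_one]
        ring
      have he := Real.add_one_le_exp
        (t * c * ∑ i, x i ^ 1 + -(t / 2) * ∑ i, x i ^ 2 + -(t ^ 2) * ∑ i, x i ^ 3)
      have hR : 0 ≤ t ^ 2 * (laguerreWeight β d x * (4 * (∑ i, x i) ^ 2 +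
          4 * c * (∑ i, x i) ^ 3)) := by positivity
      calc _ ≤ laguerreWeight β d x * (t * c * ∑ i, x i ^ 1 + -(t / 2) * ∑ i, x i ^ 2 +
            -(t ^ 2) * ∑ i, x i ^ 3 + 1) := by
            simp only [Pi.add_apply]
            linarith
        _ = selbergWeight β d x * (Real.exp (-(∑ i, x i) / 2) *
            (t * c * ∑ i, x i ^ 1 + -(t / 2) * ∑ i, x i ^ 2 +
            -(t ^ 2) * ∑ i, x i ^ 3 + 1)) := by rw [laguerreWeight_eq]; ring
        _ ≤ selbergWeight β d x * (Real.exp (-(∑ i, x i) / 2) *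
            Real.exp (t * c * ∑ i, x i ^ 1 + -(t / 2) * ∑ i, x i ^ 2 +
            -(t ^ 2) * ∑ i, x i ^ 3)) := by gcongr
        _ = selbergWeight β d x *
            (Real.exp (-(∑ i, (x i + t * x i ^ 2 + 2 * t ^ 2 * x i ^ 3)) / 2) *
            Real.exp (∑ i, c * (t * x i))) := by rw [hz]
        _ ≤ _ := by
            refine mul_le_mul_of_nonneg_left (mul_le_mul (Real.exp_le_exp.2 (by linarith)) hA
              (Real.exp_pos _).le (Real.exp_pos _).le) hD
    · have hind : 0 ≤ (mobius 1 t '' orthant d).indicator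
          (fun y => selbergWeight β d y * g y) x := by
        refine Set.indicator_nonneg (fun y hy => ?_) x
        rw [image_mobius one_pos ht.le] at hy
        refine mul_nonneg (selbergWeight_nonneg β fun i => (hy i).1)
          (mul_nonneg (Real.exp_pos _).le (Finset.prod_nonneg fun i _ => ?_))
        exact Real.rpow_nonneg (inv_nonneg.2 (by linarith [(hy i).2])) _
      refine le_trans ?_ hind
      push Not at hsmall
      obtain ⟨i, hi⟩ := hsmall
      have hts : 1 / 2 ≤ t * ∑ j, x j :=
        hi.le.trans (mul_le_mul_of_nonneg_left (le_sum_of_mem_orthant hx i) ht.le)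
      -- Away from the region `t xᵢ ≤ 1/2` the lower bound only has to be nonpositive. The remainder
      -- `4t²s²` beats `1`, and `4c t²s³` beats `t c s` because `t ≤ 1`; this is the origin of the
      -- constants in `i4` and `i5`.
      have hq : 1 ≤ 4 * (t * ∑ j, x j) ^ 2 := by nlinarith
      have hbr : 1 + t * c * ∑ i, x i + -(t / 2) * ∑ i, x i ^ 2 + -(t ^ 2) * (∑ i, x i ^ 3 +
          4 * (∑ i, x i) ^ 2 + 4 * c * (∑ i, x i) ^ 3) ≤ 0 := by
        have e1 : 0 ≤ t / 2 * ∑ i, x i ^ 2 := by positivity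
        have e2 : 0 ≤ t ^ 2 * ∑ i, x i ^ 3 := by positivity
        have e3 : t * c * ∑ i, x i ≤ 4 * c * t ^ 2 * (∑ i, x i) ^ 3 := by
          have e4 : t * (c * ∑ i, x i) ≤ 1 * (c * ∑ i, x i) :=
            mul_le_mul_of_nonneg_right ht1 (by positivity)
          have e5 : c * (∑ i, x i) * 1 ≤ c * (∑ i, x i) * (4 * (t * ∑ j, x j) ^ 2) :=
            mul_le_mul_of_nonneg_left hq (by positivity)
          linarith
        nlinarith
      have := mul_nonpos_of_nonneg_of_nonpos hw hbr
      simp only [Pi.add_apply, pow_one]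
      linarith
  rw [h6, integral_indicator hmeas, Measure.restrict_restrict hmeas,
    Set.inter_eq_left.2 (image_mobius_subset ht.le), h1] at h7
  refine le_of_mul_le_mul_left ?_ ht
  simp only [Pi.add_apply] at h7
  linarith

end Moments

/-! ### The normalized spectrum and the Jack averages -/

section Spectrum

variable {d : ℕ}

theorem sum_pos_of_mem_orthant (hd : 1 ≤ d) {x : Fin d → ℝ} (hx : x ∈ orthant d) :
    0 < ∑ i, x i :=
  Finset.sum_pos (fun i _ => hx i) ⟨⟨0, hd⟩, Finset.mem_univ _⟩

/-- The second moment of the normalized spectrum against the Laguerre weight. -/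
theorem setIntegral_laguerreWeight_mul_purity {β : ℝ} (hβ : 0 < β) (hd : 1 ≤ d) :
    ∫ x in orthant d, laguerreWeight β d x * ((∑ i, x i ^ 2) / (∑ i, x i) ^ 2) =
      (2 * β * d - β + 2) / (β * d ^ 2 + 2) * ∫ x in orthant d, laguerreWeight β d x := by
  have hd' : (1 : ℝ) ≤ d := by exact_mod_cast hd
  have hs : ∀ x ∈ orthant d, 0 < ∑ i, x i := fun x hx => sum_pos_of_mem_orthant hd hx
  have hp : ∀ x ∈ orthant d, 0 ≤ ∑ i, x i ^ 2 := fun x _ => by positivity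
  have hp' : ∀ x ∈ orthant d, ∑ i, x i ^ 2 ≤ (∑ i, x i) ^ 2 := fun x hx =>
    sum_pow_le_pow_sum hx 1
  have hsmul : ∀ (l : ℝ) (x : Fin d → ℝ), ∑ i, (l • x) i = l * ∑ i, x i := fun l x => by
    simp [Finset.mul_sum]
  have hsmul2 : ∀ (l : ℝ) (x : Fin d → ℝ), ∑ i, (l • x) i ^ 2 = l ^ 2 * ∑ i, x i ^ 2 :=
    fun l x => by simp [Finset.mul_sum, mul_pow]
  have j0 := integrableOn_laguerreWeight hβ d
  have j1 := integrableOn_laguerreWeight_mul_powerSum hβ d 0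
  have j2 := integrableOn_laguerreWeight_mul_powerSum hβ d 1
  simp only [zero_add, Nat.reduceAdd, pow_one] at j1 j2
  have k0 : IntegrableOn (fun x => laguerreWeight β d x *
      ((∑ i, x i ^ 2) / (∑ i, x i) ^ 2)) (orthant d) := by
    refine integrableOn_laguerreWeight_mul hβ (by fun_prop) (K := 1) 0 fun x hx => ?_
    have := hs x hx
    rw [abs_of_nonneg (div_nonneg (hp x hx) (by positivity)), div_le_iff₀ (by positivity)]
    simpa using hp' x hx
  have k1 : IntegrableOn (fun x => laguerreWeight β d x *
      ((∑ i, x i ^ 2) / ∑ i, x i)) (orthant d) := by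
    refine integrableOn_laguerreWeight_mul hβ (by fun_prop) (K := 1) 1 fun x hx => ?_
    have := hs x hx
    rw [abs_of_nonneg (div_nonneg (hp x hx) this.le), div_le_iff₀ this]
    nlinarith [hp' x hx]
  have c0 : Set.EqOn (fun x => laguerreWeight β d x *
      ((∑ i, x i ^ 2) / (∑ i, x i) ^ 2 * ∑ i, x i)) (fun x => laguerreWeight β d x *
      ((∑ i, x i ^ 2) / ∑ i, x i)) (orthant d) := by
    intro x hx
    have := (hs x hx).ne'
    simp only
    congr 1
    field_simp
  have c1 : Set.EqOn (fun x => laguerreWeight β d x *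
      ((∑ i, x i ^ 2) / (∑ i, x i) * ∑ i, x i)) (fun x => laguerreWeight β d x *
      ∑ i, x i ^ 2) (orthant d) := by
    intro x hx
    have := (hs x hx).ne'
    simp only
    congr 1
    field_simp
  -- Homogeneity relates `⟨1⟩` to `⟨p₁⟩`, then `⟨p₂/s²⟩` to `⟨p₂/s⟩` to `⟨p₂⟩`. The Möbius identity
  -- `m3` joins the two chains.
  have m0 := setIntegral_laguerreWeight_mul_sum (β := β) hd (h := fun _ => 1) 0
    (by simp) (by simp) (by simpa using j0) (by simpa using j1)
  have m1 := setIntegral_laguerreWeight_mul_sum (β := β) hd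
    (h := fun x => (∑ i, x i ^ 2) / (∑ i, x i) ^ 2) 0
    (fun l hl x hx => by
      have := (hs x hx).ne'
      simp only [hsmul, hsmul2]
      field_simp) (fun x hx => div_nonneg (hp x hx) (by positivity)) k0
    ((integrableOn_congr_fun c0 (measurableSet_orthant d)).2 k1)
  have m2 := setIntegral_laguerreWeight_mul_sum (β := β) hd
    (h := fun x => (∑ i, x i ^ 2) / (∑ i, x i)) 1
    (fun l hl x hx => by
      have := (hs x hx).ne'
      simp only [hsmul, hsmul2]
      field_simp) (fun x hx => div_nonneg (hp x hx) (hs x hx).le) k1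
    ((integrableOn_congr_fun c1 (measurableSet_orthant d)).2 j2)
  have m3 := le_antisymm (half_secondMoment_le hβ hd) (le_half_secondMoment hβ hd)
  rw [setIntegral_congr_fun (measurableSet_orthant d) c0] at m1
  rw [setIntegral_congr_fun (measurableSet_orthant d) c1] at m2
  simp only [one_mul, mul_one, pow_one, Nat.cast_zero, mul_zero, add_zero, Nat.cast_one,
    mobiusExponent] at m0 m1 m2 m3
  rw [m2, m1, m0] at m3
  have hn : 0 < β * d ^ 2 := by positivity
  rw [div_mul_eq_mul_div, eq_div_iff (by positivity)]
  refine mul_left_cancel₀ hn.ne' ?_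
  linear_combination 2 * m3

theorem laguerreMeasure_univ_eq {β : ℝ} (hβ : 0 < β) (d : ℕ) :
    laguerreMeasure β d Set.univ =
      ENNReal.ofReal (∫ x in orthant d, laguerreWeight β d x) := by
  rw [laguerreMeasure, withDensity_apply _ MeasurableSet.univ, Measure.restrict_univ]
  exact (ofReal_integral_eq_lintegral_ofReal (integrableOn_laguerreWeight hβ d) (by
    filter_upwards [ae_restrict_mem (measurableSet_orthant d)] with x hx
    exact laguerreWeight_nonneg β hx)).symm

theorem isProbabilityMeasure_betaLaguerre {β : ℝ} (hβ : 0 < β) (d : ℕ) :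
    IsProbabilityMeasure (betaLaguerre β d) := by
  constructor
  rw [betaLaguerre, Measure.smul_apply, smul_eq_mul, ENNReal.inv_mul_cancel]
  · rw [laguerreMeasure_univ_eq hβ]
    simpa using setIntegral_laguerreWeight_pos hβ d
  · rw [laguerreMeasure_univ_eq hβ]
    exact ENNReal.ofReal_ne_top

theorem integral_betaLaguerre {β : ℝ} (hβ : 0 < β) (d : ℕ) (f : (Fin d → ℝ) → ℝ) :
    ∫ x, f x ∂(betaLaguerre β d) = (∫ x in orthant d, laguerreWeight β d x)⁻¹ *
      ∫ x in orthant d, laguerreWeight β d x * f x := by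
  rw [betaLaguerre, integral_smul_measure, laguerreMeasure_univ_eq hβ, ENNReal.toReal_inv,
    ENNReal.toReal_ofReal (setIntegral_laguerreWeight_pos hβ d).le, smul_eq_mul]
  congr 1
  rw [laguerreMeasure, integral_withDensity_eq_integral_toReal_smul
    (measurable_laguerreWeight β d).ennreal_ofReal (by simp)]
  refine setIntegral_congr_fun (measurableSet_orthant d) fun x hx => ?_
  simp only [smul_eq_mul]
  rw [ENNReal.toReal_ofReal (laguerreWeight_nonneg β hx)]

theorem betaLaguerre_ae_mem_orthant (β : ℝ) (d : ℕ) :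
    ∀ᵐ x ∂(betaLaguerre β d), x ∈ orthant d := by
  refine Measure.ae_smul_measure ?_ _
  exact (withDensity_absolutelyContinuous _ _).ae_le (ae_restrict_mem (measurableSet_orthant d))

theorem measurable_normalize (d : ℕ) :
    Measurable fun (x : Fin d → ℝ) i => x i / ∑ j, x j := by
  fun_prop

theorem isProbabilityMeasure_sphereSpectrum {β : ℝ} (hβ : 0 < β) (d : ℕ) :
    IsProbabilityMeasure (sphereSpectrum β d) := by
  have := isProbabilityMeasure_betaLaguerre hβ d
  exact Measure.isProbabilityMeasure_map (measurable_normalize d).aemeasurable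

theorem measurable_powerSum (k d : ℕ) : Measurable fun a : Fin d → ℝ => powerSum k a := by
  unfold powerSum
  fun_prop

theorem sphereSpectrum_ae_powerSum_one (β : ℝ) (hd : 1 ≤ d) :
    ∀ᵐ a ∂(sphereSpectrum β d), powerSum 1 a = 1 := by
  rw [sphereSpectrum, ae_map_iff (measurable_normalize d).aemeasurable
    (measurableSet_eq_fun (measurable_powerSum 1 d) measurable_const)]
  filter_upwards [betaLaguerre_ae_mem_orthant β d] with x hx
  simp only [powerSum, pow_one, ← Finset.sum_div]
  exact div_self (sum_pos_of_mem_orthant hd hx).ne'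

theorem integrable_powerSum_two {β : ℝ} (hβ : 0 < β) (hd : 1 ≤ d) :
    Integrable (fun a => powerSum 2 a) (sphereSpectrum β d) := by
  have := isProbabilityMeasure_sphereSpectrum hβ d
  refine Integrable.of_bound (measurable_powerSum 2 d).aestronglyMeasurable 1 ?_
  rw [sphereSpectrum, ae_map_iff (measurable_normalize d).aemeasurable
    (measurableSet_le (measurable_powerSum 2 d).norm measurable_const)]
  filter_upwards [betaLaguerre_ae_mem_orthant β d] with x hx
  have hs := sum_pos_of_mem_orthant hd hx
  simp only [powerSum, div_pow, ← Finset.sum_div]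
  rw [Real.norm_of_nonneg (by positivity), div_le_one (by positivity)]
  exact sum_pow_le_pow_sum hx 1

/-- The mean purity of the normalized `β`-Laguerre ensemble. -/
theorem integral_powerSum_two {β : ℝ} (hβ : 0 < β) (hd : 1 ≤ d) :
    ∫ a, powerSum 2 a ∂(sphereSpectrum β d) = (2 * β * d - β + 2) / (β * d ^ 2 + 2) := by
  rw [sphereSpectrum, integral_map (measurable_normalize d).aemeasurable
    (measurable_powerSum 2 d).aestronglyMeasurable, integral_betaLaguerre hβ]
  simp only [powerSum, div_pow, ← Finset.sum_div]
  rw [setIntegral_laguerreWeight_mul_purity hβ hd]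
  have := (setIntegral_laguerreWeight_pos hβ d).ne'
  field_simp

theorem HasMean.congr {Ω : Type*} [MeasurableSpace Ω] {P : Measure Ω} {X Y : Ω → ℝ} {m : ℝ}
    (h : HasMean P X m) (hXY : Y =ᵐ[P] X) : HasMean P Y m :=
  ⟨h.1.congr hXY.symm, (integral_congr_ae hXY).trans h.2⟩

theorem sphereSpectrum_prod_ae {β : ℝ} (hβ : 0 < β) (hd : 1 ≤ d) :
    ∀ᵐ ab ∂((sphereSpectrum β d).prod (sphereSpectrum β d)),
      powerSum 1 ab.1 = 1 ∧ powerSum 1 ab.2 = 1 := by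
  have := isProbabilityMeasure_sphereSpectrum hβ d
  have h := sphereSpectrum_ae_powerSum_one β hd
  have h1 := (Measure.quasiMeasurePreserving_fst (μ := sphereSpectrum β d)
    (ν := sphereSpectrum β d)).ae h
  have h2 := (Measure.quasiMeasurePreserving_snd (μ := sphereSpectrum β d)
    (ν := sphereSpectrum β d)).ae h
  filter_upwards [h1, h2] with ab ha hb using ⟨ha, hb⟩

theorem hasMean_haarMeanTr {β : ℝ} (hβ : 0 < β) (hd : 1 ≤ d) :
    HasMean ((sphereSpectrum β d).prod (sphereSpectrum β d))
      (fun ab => haarMeanTr ab.1 ab.2) (1 / (d : ℝ)) := by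
  have := isProbabilityMeasure_sphereSpectrum hβ d
  refine HasMean.congr (X := fun _ => 1 / (d : ℝ)) ⟨integrable_const _, by simp⟩ ?_
  filter_upwards [sphereSpectrum_prod_ae hβ hd] with ab hab
  simp only [haarMeanTr, jack1, hab.1, hab.2]
  simp [powerSum]

theorem hasMean_prod_mul {S : Type*} [MeasurableSpace S] {μ : Measure S} [SFinite μ] {f : S → ℝ}
    {m : ℝ} (hf : HasMean μ f m) : HasMean (μ.prod μ) (fun z => f z.1 * f z.2) (m * m) := by
  refine ⟨hf.1.mul_prod hf.1, ?_⟩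
  rw [integral_prod_mul, hf.2]

/-- After simplification the numerator is `((βd + 2)³ - (β(d - 1))³)/(β + 2)`. As `β + 2` is the
difference of the two bases, the quotient is the polynomial in `quarticValue`. -/
theorem haarMeanTrSq_value {β : ℝ} (hβ : 0 < β) (hd : 1 ≤ d) :
    (1 + 2 / β)⁻¹ * ((1 + 2 / β * ((2 * β * d - β + 2) / (β * d ^ 2 + 2))) *
        (1 + 2 / β * ((2 * β * d - β + 2) / (β * d ^ 2 + 2))) / jack2 β (1 : Fin d → ℝ)) -
      (1 + 2 / β)⁻¹ * ((1 - (2 * β * d - β + 2) / (β * d ^ 2 + 2)) *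
        (1 - (2 * β * d - β + 2) / (β * d ^ 2 + 2)) / jack11 (1 : Fin d → ℝ)) =
      quarticValue β d := by
  have hd0 : (0 : ℝ) < d := by exact_mod_cast hd
  have h1 : jack2 β (1 : Fin d → ℝ) = d * (β * d + 2) / β := by
    simp [jack2, powerSum]; field_simp
  have h2 : jack11 (1 : Fin d → ℝ) = d * (d - 1) := by
    simp [jack11, powerSum]; ring
  have hn : β * d ^ 2 + 2 ≠ 0 := by positivity
  have e1 : 1 + 2 / β * ((2 * β * d - β + 2) / (β * d ^ 2 + 2)) =
      (β * d + 2) ^ 2 / (β * (β * d ^ 2 + 2)) := by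
    field_simp; ring
  have e2 : 1 - (2 * β * d - β + 2) / (β * d ^ 2 + 2) = β * (d - 1) ^ 2 / (β * d ^ 2 + 2) := by
    field_simp; ring
  have e3 : (1 + 2 / β)⁻¹ = β / (β + 2) := by field_simp
  have e4 : β * (d - 1 : ℝ) ^ 2 / (β * d ^ 2 + 2) * (β * (d - 1) ^ 2 / (β * d ^ 2 + 2)) /
      (d * (d - 1)) = β ^ 2 * (d - 1) ^ 3 / (d * (β * d ^ 2 + 2) ^ 2) := by
    -- For `d = 1` the left side is `0/0`, which is `0` by convention, matching the omitted Jack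
    -- term.
    by_cases h : (d : ℝ) - 1 = 0
    · simp [h]
    · field_simp
  rw [h1, h2, e1, e2, e3, e4, quarticValue]
  have : β + 2 ≠ 0 := by positivity
  have : β * d + 2 ≠ 0 := by positivity
  field_simp
  ring

/-- Almost surely `p₁ = 1`, so the integrand is a combination of two products of affine functions of
`p₂(a)` and `p₂(b)`, whose means factor by independence. -/
theorem hasMean_haarMeanTrSq {β : ℝ} (hβ : 0 < β) (hd : 1 ≤ d) :
    HasMean ((sphereSpectrum β d).prod (sphereSpectrum β d))
      (fun ab => haarMeanTrSq β ab.1 ab.2) (quarticValue β d) := by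
  have := isProbabilityMeasure_sphereSpectrum hβ d
  have hi := integrable_powerSum_two hβ hd
  have hm := integral_powerSum_two hβ hd
  have hf : HasMean (sphereSpectrum β d) (fun a => 1 + 2 / β * powerSum 2 a)
      (1 + 2 / β * ((2 * β * d - β + 2) / (β * d ^ 2 + 2))) := by
    refine ⟨(integrable_const _).add (hi.const_mul _), ?_⟩
    rw [integral_add (integrable_const _) (hi.const_mul _), integral_const_mul, hm]
    simp
  have hg : HasMean (sphereSpectrum β d) (fun a => 1 - powerSum 2 a)
      (1 - (2 * β * d - β + 2) / (β * d ^ 2 + 2)) := by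
    refine ⟨(integrable_const _).sub hi, ?_⟩
    rw [integral_sub (integrable_const _) hi, hm]
    simp
  obtain ⟨f1, f2⟩ := hasMean_prod_mul hf
  obtain ⟨g1, g2⟩ := hasMean_prod_mul hg
  rw [← haarMeanTrSq_value hβ hd]
  have i1 := (f1.div_const (jack2 β (1 : Fin d → ℝ))).const_mul (1 + 2 / β)⁻¹
  have i2 := (g1.div_const (jack11 (1 : Fin d → ℝ))).const_mul (1 + 2 / β)⁻¹
  refine HasMean.congr ⟨i1.sub i2, ?_⟩ ?_
  · simp only [Pi.sub_apply]
    rw [integral_sub i1 i2, integral_const_mul, integral_const_mul, integral_div, integral_div,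
      f2, g2]
  · filter_upwards [sphereSpectrum_prod_ae hβ hd] with ab hab
    simp only [haarMeanTrSq, jack2, jack11, hab.1, hab.2, one_pow, Pi.sub_apply]

end Spectrum

end BetaSphere

end

theorem mainTheorem7 {Ω : Type*} [MeasurableSpace Ω] (P : Measure Ω) [IsProbabilityMeasure P]
    (d : ℕ) (hd : 1 ≤ d) :
    -- real entries, `β = 1`
    (∀ x y : Ω → BetaSphere.TwoSite ℝ d,
      HasLaw x (BetaSphere.uniformSphere (BetaSphere.TwoSite ℝ d)) P →
      HasLaw y (BetaSphere.uniformSphere (BetaSphere.TwoSite ℝ d)) P →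
      IndepFun x y P →
      BetaSphere.HasMean P
        (fun ω => BetaSphere.frobSq (BetaSphere.reshape (x ω) * BetaSphere.reshape (y ω)))
        (1 / (d : ℝ)) ∧
      BetaSphere.HasMean P
        (fun ω => BetaSphere.frobSq
          ((BetaSphere.reshape (x ω) * BetaSphere.reshape (y ω)) *
            (BetaSphere.reshape (x ω) * BetaSphere.reshape (y ω))ᴴ))
        (BetaSphere.quarticValue 1 d)) ∧
    -- complex entries, `β = 2`
    (∀ x y : Ω → BetaSphere.TwoSite ℂ d,
      HasLaw x (BetaSphere.uniformSphere (BetaSphere.TwoSite ℂ d)) P →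
      HasLaw y (BetaSphere.uniformSphere (BetaSphere.TwoSite ℂ d)) P →
      IndepFun x y P →
      BetaSphere.HasMean P
        (fun ω => BetaSphere.frobSq (BetaSphere.reshape (x ω) * BetaSphere.reshape (y ω)))
        (1 / (d : ℝ)) ∧
      BetaSphere.HasMean P
        (fun ω => BetaSphere.frobSq
          ((BetaSphere.reshape (x ω) * BetaSphere.reshape (y ω)) *
            (BetaSphere.reshape (x ω) * BetaSphere.reshape (y ω))ᴴ))
        (BetaSphere.quarticValue 2 d)) ∧
    -- quaternionic entries, `β = 4`
    (∀ x y : Ω → BetaSphere.TwoSite (Quaternion ℝ) d,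
      HasLaw x (BetaSphere.uniformSphere (BetaSphere.TwoSite (Quaternion ℝ) d)) P →
      HasLaw y (BetaSphere.uniformSphere (BetaSphere.TwoSite (Quaternion ℝ) d)) P →
      IndepFun x y P →
      BetaSphere.HasMean P
        (fun ω => BetaSphere.frobSq (BetaSphere.reshape (x ω) * BetaSphere.reshape (y ω)))
        (1 / (d : ℝ)) ∧
      BetaSphere.HasMean P
        (fun ω => BetaSphere.frobSq
          ((BetaSphere.reshape (x ω) * BetaSphere.reshape (y ω)) *
            (BetaSphere.reshape (x ω) * BetaSphere.reshape (y ω))ᴴ))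
        (BetaSphere.quarticValue 4 d)) ∧
    -- general `β`
    (∀ β : ℝ, 0 < β →
      BetaSphere.HasMean
        ((BetaSphere.sphereSpectrum β d).prod (BetaSphere.sphereSpectrum β d))
        (fun ab => BetaSphere.haarMeanTr ab.1 ab.2) (1 / (d : ℝ)) ∧
      BetaSphere.HasMean
        ((BetaSphere.sphereSpectrum β d).prod (BetaSphere.sphereSpectrum β d))
        (fun ab => BetaSphere.haarMeanTrSq β ab.1 ab.2) (BetaSphere.quarticValue β d)) := by
  refine ⟨fun x y hx hy hxy => ?_, fun x y hx hy hxy => ?_, fun x y hx hy hxy => ?_,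
    fun β hβ => ⟨BetaSphere.hasMean_haarMeanTr hβ hd, BetaSphere.hasMean_haarMeanTrSq hβ hd⟩⟩
  · simpa using BetaSphere.hasMean_frobSq BetaSphere.realCompositionBasis one_ne_zero hd hx hy hxy
  · simpa using
      BetaSphere.hasMean_frobSq BetaSphere.complexCompositionBasis two_ne_zero hd hx hy hxy
  · simpa using
      BetaSphere.hasMean_frobSq BetaSphere.quaternionCompositionBasis four_ne_zero hd hx hy hxy
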